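/- Let $p$ be an odd prime, let $m,k$ be positive integers, put $d=\gcd(m,k)$, and assume $m/d\ge 3$ and $1\le v_2(m)<v_2(k)$, where $v_2$ is the $2$-adic valuation (so $m$ and $d$ are even and $m/d$ is odd). Let $\pi$ be a primitive element of $\mathbb{F}_{p^m}$ (a generator of its multiplicative group), let $\zeta_p\in\mathbb{C}$ be a primitive $p$-th root of unity, and let $\mathrm{Tr}$ be the trace from $\mathbb{F}_{p^m}$ to $\mathbb{F}_p$. For $\alpha,\beta\in\mathbb{F}_{p^m}$ define $$T(\alpha,\beta)=\sum_{x\in\mathbb{F}_{p^m}}\zeta_p^{\mathrm{Tr}(\alpha x^{p^k+1}+\beta x^2)},\qquad S(\alpha,\beta)=T(\alpha,\beta)+T\bigl(\pi^{\frac{p^k+1}{2}}\alpha,\,-\pi\beta\bigr).$$ Then, as $(\alpha,\beta)$ runs over $\mathbb{F}_{p^m}^2$, the value distribution of $S(\alpha,\beta)$ is given by the following table, in which each row with a sign $\pm$ stands for two rows, one for each sign, both with the stated frequency: $$\begin{array}{l|l} \text{value} & \text{frequency}\\ \hline 2p^m & 1\\ 0 & \frac12\,(p^{m+d}-3p^m+p^d+1)(p^m-1)/(p^d-1)\\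 \pm(p^d-1)p^{m/2} & (p^{m-d}-1)(p^m-1)/(p^{2d}-1)\\ (\pm1-p^{d/2})p^{m/2} & \frac12\,p^{(m-d)/2}(p^{(m-d)/2}-1)(p^m-1)\\ (\pm1+p^{d/2})p^{m/2} & \frac12\,p^{(m-d)/2}(p^{(m-d)/2}+1)(p^m-1)\\ \pm2p^{m/2} & \frac14\,(p^d-1)(p^{2m}-1)/(p^d+1) \end{array}$$ That is, for every $v\in\mathbb{C}$, the number of pairs $(\alpha,\beta)\in\mathbb{F}_{p^m}^2$ with $S(\alpha,\beta)=v$ is the sum of the frequencies of all rows whose value equals $v$ (and is $0$ if there is no such row). If $p^{d/2}\neq 3$, the number of pairs at which $S$ takes the value of a given row is exactly the frequency of that row. -/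

import Mathlib

/-- The exponential sum `T(α, β) = ∑_{x ∈ F} ζ ^ Tr(α x^(p^k+1) + β x^2)`, where `Tr` is the trace
from `F` to the prime field `ZMod p` and `ζ` is a complex `p`-th root of unity. -/
noncomputable def expSumT (p k : ℕ) {F : Type*} [Field F] [Fintype F] [Algebra (ZMod p) F]
    (ζ : ℂ) (α β : F) : ℂ :=
  ∑ x : F, ζ ^ (Algebra.trace (ZMod p) F (α * x ^ (p ^ k + 1) + β * x ^ 2)).val

/-- The exponential sum `S(α, β) = T(α, β) + T(π^((p^k+1)/2) α, -π β)`
(the division `(p^k+1)/2` is exact for odd `p`). -/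
noncomputable def expSumS (p k : ℕ) {F : Type*} [Field F] [Fintype F] [Algebra (ZMod p) F]
    (ζ : ℂ) (π α β : F) : ℂ :=
  expSumT p k ζ α β + expSumT p k ζ (π ^ ((p ^ k + 1) / 2) * α) (-π * β)

/-- The table of pairs (value, frequency) of the sum `S`. It is used for even `m` and `d` only, where
the divisions `m / 2`, `d / 2` and `(m - d) / 2` in the exponents are exact. The frequencies are
written in `ℚ`, so that the other divisions are true divisions. -/
noncomputable def valueTable (p m d : ℕ) : List (ℂ × ℚ) :=
  [ (2 * (p : ℂ) ^ m, 1),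
    (0, 1 / 2 * ((p : ℚ) ^ (m + d) - 3 * (p : ℚ) ^ m + (p : ℚ) ^ d + 1) * ((p : ℚ) ^ m - 1)
          / ((p : ℚ) ^ d - 1)),
    (((p : ℂ) ^ d - 1) * (p : ℂ) ^ (m / 2),
        ((p : ℚ) ^ (m - d) - 1) * ((p : ℚ) ^ m - 1) / ((p : ℚ) ^ (2 * d) - 1)),
    (-((p : ℂ) ^ d - 1) * (p : ℂ) ^ (m / 2),
        ((p : ℚ) ^ (m - d) - 1) * ((p : ℚ) ^ m - 1) / ((p : ℚ) ^ (2 * d) - 1)),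
    ((1 - (p : ℂ) ^ (d / 2)) * (p : ℂ) ^ (m / 2),
        1 / 2 * (p : ℚ) ^ ((m - d) / 2) * ((p : ℚ) ^ ((m - d) / 2) - 1) * ((p : ℚ) ^ m - 1)),
    ((-1 - (p : ℂ) ^ (d / 2)) * (p : ℂ) ^ (m / 2),
        1 / 2 * (p : ℚ) ^ ((m - d) / 2) * ((p : ℚ) ^ ((m - d) / 2) - 1) * ((p : ℚ) ^ m - 1)),
    ((1 + (p : ℂ) ^ (d / 2)) * (p : ℂ) ^ (m / 2),
        1 / 2 * (p : ℚ) ^ ((m - d) / 2) * ((p : ℚ) ^ ((m - d) / 2) + 1) * ((p : ℚ) ^ m - 1)),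
    ((-1 + (p : ℂ) ^ (d / 2)) * (p : ℂ) ^ (m / 2),
        1 / 2 * (p : ℚ) ^ ((m - d) / 2) * ((p : ℚ) ^ ((m - d) / 2) + 1) * ((p : ℚ) ^ m - 1)),
    (2 * (p : ℂ) ^ (m / 2),
        1 / 4 * ((p : ℚ) ^ d - 1) * ((p : ℚ) ^ (2 * m) - 1) / ((p : ℚ) ^ d + 1)),
    (-2 * (p : ℂ) ^ (m / 2),
        1 / 4 * ((p : ℚ) ^ d - 1) * ((p : ℚ) ^ (2 * m) - 1) / ((p : ℚ) ^ d + 1)) ]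

open scoped Classical in
/-- The total frequency that a list of pairs (value, frequency) assigns to `v`: the sum of the
frequencies of all entries whose value is `v` (in particular `0` if there is no such entry). -/
noncomputable def totalFrequency (table : List (ℂ × ℚ)) (v : ℂ) : ℚ :=
  (table.map fun row => if row.1 = v then row.2 else 0).sum

/-!
The proof is elementary: it computes moments and never evaluates a quadratic Gauss sum.

Write `q = p ^ m = |F|`, `d = gcd m k`, `σ x = x ^ (p ^ k)`, let `K` be the fixed field of `σ`, so
that `|K| = p ^ d` and `n = [F : K] = m / d` is odd, and put `a = p ^ (d / 2)`, `b = p ^ (m / 2)`.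
Then `T(α, β)` is the character sum of the `K`-quadratic form `Q(x) = Tr (α x σ(x) + β x²)`. As `-1`
is a square in `K`, it is real and `T² = q |Rad Q|`. If `(α, β) ≠ 0`, then `Rad Q` has dimension at
most `2` over `K` (`exists_card_twistedRadical_eq`), so `T = ± b a ^ j` with `j ≤ 2` the corank.
Diagonalization shows that scaling `(α, β)` by a nonsquare of `K` multiplies `T` by
`(-1) ^ (n - j)`, so it changes the sign exactly for even `j`.

The second summand of `S` is `T` at the companion coefficients `(-ρ ν α, ν β)`, where `ν = -π` is a
nonsquare and `ρ = ν ^ ((p ^ k - 1) / 2)`; formally it belongs to the form with coefficients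
`(-α, β)` restricted to `s F`, where `s² = ν`. Apart from `-ν` being a nonsquare, what links
the two forms is one remark: `y + ρ σ(y) = 0` only for `y = 0`. Otherwise `c = ν y²`
would satisfy `c ^ ((p ^ k - 1) / 2) = -1`; then `c` lies in `K`, but `p ^ d - 1` divides
`(p ^ k - 1) / 2` because `k / d` is even. The remark implies that the two forms are never both
degenerate (`twistedRadical_eq_bot_or`).

The substitution `x ↦ u x` moves any nonzero radical vector to `1`, and `1 ∈ Rad Q` means
`2 β = -(α + σ⁻¹ α)`. This makes sums over all `(α, β)` weighted by `|Rad Q|` computable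
(`sum_card_twistedRadical_mul`) and gives the moments `∑ T`, `∑ |Rad|`, `∑ |Rad|²`, `∑ T T'` and
`∑ |Rad| T T'`, where `T'` is the companion sum. Since taking companions is an involution up to
substitution, the joint distribution of `(T, T')` is symmetric, and it is invariant under scaling
by a nonsquare of `K`. Six unknown frequencies remain, and the number of pairs together with
these five moments determines them linearly (`joint_distribution_of_moments`). In particular, if
one form has corank two, the signs of `T` and `T'` are always opposite.
-/

/-! ### Character sums of quadratic forms over a finite field -/

section QuadraticCharacterSums

open Module

variable {K V : Type*} [Field K] [AddCommGroup V] [Module K V] [Fintype V]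
  {ψ : AddChar K ℂ}

theorem sum_addChar_linearMap_eq_zero (hψ : ψ ≠ 1) {f : V →ₗ[K] K} (hf : f ≠ 0) :
    ∑ x, ψ (f x) = 0 := by
  have hs : Function.Surjective f := LinearMap.surjective hf
  have : ψ.compAddMonoidHom f.toAddMonoidHom ≠ 1 := by
    intro h
    apply hψ
    ext x
    obtain ⟨y, rfl⟩ := hs x
    simpa using DFunLike.congr_fun h y
  simpa using AddChar.sum_eq_zero_of_ne_one this

/-- The character sum of a quadratic form over a finite field has squared absolute value
`|V| * |radical|`. -/
theorem sum_form_mul_sum_neg_form (hψ : ψ ≠ 1) (h2 : (2 : K) ≠ 0) {B : LinearMap.BilinForm K V}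
    (hB : B.IsSymm) :
    (∑ x, ψ (B x x)) * ∑ x, ψ (-B x x) = Fintype.card V * Nat.card (LinearMap.ker B) := by
  classical
  have key : ∀ z, ∑ y, ψ (B z z + 2 * B z y) =
      if z ∈ LinearMap.ker B then (Fintype.card V : ℂ) else 0 := by
    intro z
    split_ifs with hz
    · have : B z = 0 := hz
      simp [this]
    · have : (2 : K) • B z ≠ 0 := smul_ne_zero h2 hz
      have := sum_addChar_linearMap_eq_zero hψ this
      simp only [AddChar.map_add_eq_mul, ← Finset.mul_sum]
      simp only [LinearMap.smul_apply, smul_eq_mul] at this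
      rw [this, mul_zero]
  calc (∑ x, ψ (B x x)) * ∑ x, ψ (-B x x)
      = ∑ y, ∑ x, ψ (B x x - B y y) := by
        rw [Finset.sum_mul_sum, Finset.sum_comm]
        simp only [sub_eq_add_neg, AddChar.map_add_eq_mul]
    _ = ∑ y, ∑ z, ψ (B z z + 2 * B z y) := by
        refine Finset.sum_congr rfl fun y _ => ?_
        rw [← Equiv.sum_comp (Equiv.addRight y)]
        refine Finset.sum_congr rfl fun z _ => ?_
        congr 1
        have := hB.eq z y
        simp only [Equiv.coe_addRight, map_add, LinearMap.add_apply, ← this]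
        ring
    _ = _ := by
        rw [Finset.sum_comm]
        simp only [key]
        rw [← Finset.sum_filter, Finset.sum_const, nsmul_eq_mul, mul_comm,
          Nat.card_eq_fintype_card, Fintype.card_subtype]

variable [Fintype K]

theorem addChar_map_sum_eq_prod {A M ι : Type*} [AddCommMonoid A] [CommMonoid M] (φ : AddChar A M)
    (s : Finset ι) (f : ι → A) : φ (∑ i ∈ s, f i) = ∏ i ∈ s, φ (f i) := by
  classical
  induction s using Finset.induction_on with
  | empty => simp
  | insert i s hi ih => rw [Finset.sum_insert hi, Finset.prod_insert hi, AddChar.map_add_eq_mul, ih]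

/-- Diagonalizing a quadratic form factors its character sum into one-variable sums. -/
theorem exists_diagonal_sum_form (ψ : AddChar K ℂ) (h2 : (2 : K) ≠ 0)
    {B : LinearMap.BilinForm K V} (hB : B.IsSymm) :
    ∃ w : Fin (finrank K V) → K,
      ∀ c, ∑ x, ψ (c * B x x) = ∏ i, ∑ t, ψ (c * w i * t ^ 2) := by
  classical
  have : Invertible (2 : K) := invertibleOfNonzero h2
  obtain ⟨v, hv⟩ := LinearMap.BilinForm.exists_orthogonal_basis
    (LinearMap.BilinForm.isSymm_iff.1 hB)
  refine ⟨fun i => B (v i) (v i), fun c => ?_⟩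
  have hdiag : ∀ g : Fin (finrank K V) → K,
      B (v.equivFun.symm g) (v.equivFun.symm g) = ∑ i, B (v i) (v i) * g i ^ 2 := by
    intro g
    rw [Basis.equivFun_symm_apply]
    simp only [map_sum, LinearMap.sum_apply, map_smul, LinearMap.smul_apply, smul_eq_mul]
    refine Finset.sum_congr rfl fun i _ => ?_
    rw [Finset.sum_eq_single i]
    · ring
    · intro j _ hji
      have : B (v j) (v i) = 0 := hv hji
      simp [this]
    · simp
  rw [← Equiv.sum_comp v.equivFun.symm.toEquiv, Finset.prod_univ_sum, Fintype.piFinset_univ]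
  refine Finset.sum_congr rfl fun g _ => ?_
  have := hdiag g
  simp only [LinearEquiv.coe_toEquiv]
  rw [this, Finset.mul_sum, addChar_map_sum_eq_prod]
  refine Finset.prod_congr rfl fun i _ => ?_
  rw [mul_assoc]

/-- The case of a form of rank one on `K` itself. -/
theorem sum_addChar_mul_sq_mul_neg (hψ : ψ ≠ 1) (h2 : (2 : K) ≠ 0) {w : K} (hw : w ≠ 0) :
    (∑ t, ψ (w * t ^ 2)) * ∑ t, ψ (-1 * w * t ^ 2) = Fintype.card K := by
  let B : LinearMap.BilinForm K K := w • LinearMap.mul K K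
  have hBa : ∀ x y, B x y = w * (x * y) := fun x y => rfl
  have hB : B.IsSymm := ⟨fun x y => by simp [hBa, mul_comm]⟩
  have hker : LinearMap.ker B = ⊥ := by
    rw [LinearMap.ker_eq_bot']
    intro x hx
    have : B x 1 = 0 := by rw [hx]; rfl
    simpa [hBa, hw] using this
  have := sum_form_mul_sum_neg_form hψ h2 hB
  rw [hker] at this
  simpa [hBa, sq] using this

/-- The one-variable sums for `w` and for a nonsquare multiple of `w` cancel: together the
arguments `w t²` and `c w t²` run twice through the field. -/
theorem sum_addChar_nonsquare_mul_sq (hψ : ψ ≠ 1) (h2 : (2 : K) ≠ 0) {c w : K}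
    (hc : ¬IsSquare c) (hw : w ≠ 0) :
    ∑ t, ψ (c * w * t ^ 2) = -∑ t, ψ (w * t ^ 2) := by
  classical
  have hchar : ringChar K ≠ 2 := fun h => h2 (by
    have := ringChar.Nat.cast_ringChar (R := K)
    rw [h] at this
    exact_mod_cast this)
  -- `x` has `χ(x) + 1` square roots, and the term `1` contributes `∑ ψ (u x) = 0`
  have key : ∀ u : K, u ≠ 0 → ∑ t, ψ (u * t ^ 2) = ∑ x, (quadraticChar K x : ℂ) * ψ (u * x) := by
    intro u hu
    have h0 : ∑ x, ψ (u * x) = 0 := by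
      have := sum_addChar_linearMap_eq_zero (V := K) hψ (f := LinearMap.mul K K u)
        (fun h => hu (by simpa using LinearMap.congr_fun h 1))
      simpa using this
    rw [← add_zero (∑ x, (quadraticChar K x : ℂ) * ψ (u * x)), ← h0, ← Finset.sum_add_distrib,
      ← Finset.sum_fiberwise' Finset.univ (fun t : K => t ^ 2) (fun x => ψ (u * x))]
    refine Finset.sum_congr rfl fun x _ => ?_
    rw [Finset.sum_const, nsmul_eq_mul]
    have := quadraticChar_card_sqrts hchar x
    have h3 : ((Finset.univ.filter fun t : K => t ^ 2 = x).card : ℤ) = quadraticChar K x + 1 := by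
      rw [← this]
      congr 2
      ext t
      simp
    have h4 : ((Finset.univ.filter fun t : K => t ^ 2 = x).card : ℂ) =
        (quadraticChar K x : ℂ) + 1 := by exact_mod_cast h3
    rw [h4]
    ring
  have hc0 : c ≠ 0 := fun h => hc (h ▸ IsSquare.zero)
  have hχ : quadraticChar K c = -1 := quadraticChar_neg_one_iff_not_isSquare.2 hc
  rw [key _ (mul_ne_zero hc0 hw), key _ hw, ← Finset.sum_neg_distrib,
    ← Equiv.sum_comp (Equiv.mulLeft₀ c hc0)
      (fun x => -((quadraticChar K x : ℂ) * ψ (w * x)))]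
  refine Finset.sum_congr rfl fun x _ => ?_
  simp only [Equiv.mulLeft₀_apply, map_mul, hχ]
  push_cast
  rw [show w * (c * x) = c * w * x by ring]
  ring

/-- Scaling a quadratic form of rank `r` by a nonsquare multiplies its character sum
by `(-1) ^ r`. -/
theorem sum_nonsquare_mul_form (hψ : ψ ≠ 1) (h2 : (2 : K) ≠ 0) {B : LinearMap.BilinForm K V}
    (hB : B.IsSymm) {c : K} (hc : ¬IsSquare c) {j : ℕ}
    (hj : Nat.card (LinearMap.ker B) = Fintype.card K ^ j) :
    ∑ x, ψ (c * B x x) = (-1) ^ (finrank K V + j) * ∑ x, ψ (B x x) := by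
  classical
  have hdiag := exists_diagonal_sum_form ψ h2 hB
  have hV : Fintype.card V = Fintype.card K ^ finrank K V := card_eq_pow_finrank
  set n := finrank K V with hn
  clear_value n
  obtain ⟨w, hw⟩ := hdiag
  set s := Finset.univ.filter fun i => w i ≠ 0
  have h1 : ∑ x, ψ (c * B x x) = (-1) ^ s.card * ∑ x, ψ (B x x) := by
    have hw1 := hw 1
    simp only [one_mul] at hw1
    rw [hw, hw1, ← Finset.prod_const, Finset.prod_filter, ← Finset.prod_mul_distrib]
    refine Finset.prod_congr rfl fun i _ => ?_
    split_ifs with hi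
    · rw [sum_addChar_nonsquare_mul_sq hψ h2 hc hi, neg_one_mul]
    · have : w i = 0 := by simpa using hi
      simp [this]
  have hq : 1 < Fintype.card K := Fintype.one_lt_card
  -- the rank `s.card` is compared with the corank `j` through the absolute value of the sum
  have h3 : (Fintype.card K : ℂ) ^ (n + j) * (Fintype.card K : ℂ) ^ s.card =
      (Fintype.card K : ℂ) ^ (2 * n) := by
    have := sum_form_mul_sum_neg_form hψ h2 hB
    have hw1 := hw 1
    have hw2 := hw (-1)
    simp only [one_mul] at hw1
    simp only [neg_mul, one_mul] at hw2
    rw [hw1, hw2, ← Finset.prod_mul_distrib, hj, hV] at this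
    push_cast at this
    rw [← pow_add] at this
    rw [← this, ← Finset.prod_const, Finset.prod_filter, ← Finset.prod_mul_distrib]
    rw [show (Fintype.card K : ℂ) ^ (2 * n) = ∏ _i : Fin n, (Fintype.card K : ℂ) ^ 2 by
      simp [pow_mul]]
    refine Finset.prod_congr rfl fun i _ => ?_
    split_ifs with hi
    · have := sum_addChar_mul_sq_mul_neg hψ h2 hi
      simp only [neg_mul, one_mul] at this
      rw [this, sq]
    · have : w i = 0 := by simpa using hi
      simp [this, sq]
  have h4 : n + j + s.card = 2 * n := by
    rw [← pow_add] at h3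
    exact Nat.pow_right_injective hq (by exact_mod_cast h3)
  rw [h1]
  congr 1
  have : (-1 : ℂ) ^ (n + j) * (-1) ^ s.card = 1 := by
    rw [← pow_add, h4]; simp
  rcases neg_one_pow_eq_or ℂ s.card with h | h <;> rw [h] at this ⊢
  · simpa using this.symm
  · linear_combination this

end QuadraticCharacterSums

/-! ### The quadratic forms `Tr (α x σ(x) + β x²)` -/

section TwistedForm

open Module

variable {K F : Type*} [Field K] [Field F] [Algebra K F]

/-- In characteristic other than two, the symmetric bilinear form of the quadratic form
`x ↦ Tr (α x σ(x) + β x²)` on `F`, with the coefficients packed as `p = (α, β)`. -/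
noncomputable def twistedForm (σ : F ≃ₐ[K] F) (p : F × F) : LinearMap.BilinForm K F :=
  LinearMap.mk₂ K
    (fun x y => Algebra.trace K F (2⁻¹ * p.1 * (x * σ y + σ x * y) + p.2 * (x * y)))
    (fun x x' y => by rw [← map_add (Algebra.trace K F), map_add σ]; congr 1; ring)
    (fun c x y => by
      rw [← map_smul, map_smul]
      congr 1
      simp only [Algebra.smul_def]; ring)
    (fun x y y' => by rw [← map_add (Algebra.trace K F), map_add σ]; congr 1; ring)
    (fun c x y => by
      rw [← map_smul, map_smul]
      congr 1
      simp only [Algebra.smul_def]; ring)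

/-- The radical of the form with coefficients `p = (α, β)`. -/
noncomputable def twistedRadical (σ : F ≃ₐ[K] F) (p : F × F) : Submodule K F :=
  LinearMap.ker (twistedForm σ p)

/-- The character sum of the quadratic form `x ↦ Tr (α x σ(x) + β x²)`. -/
noncomputable def twistedSum [Fintype F] (σ : F ≃ₐ[K] F) (ψ : AddChar K ℂ) (p : F × F) : ℂ :=
  ∑ x, ψ (Algebra.trace K F (p.1 * (x * σ x) + p.2 * x ^ 2))

/-- The coefficients of the form `x ↦ Q(u x)`, where `Q` has coefficients `p`. -/
def substCoeff (σ : F ≃ₐ[K] F) (u : F) (p : F × F) : F × F :=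
  (p.1 * (u * σ u), p.2 * u ^ 2)

/-- Formally, the coefficients of `x ↦ Q(s x)`, where `Q` has coefficients `(-α, β)` and `s` is a
square root of `ν` with `σ(s) = ρ s` in an extension of `F`. -/
def companionCoeff (ν ρ : F) (p : F × F) : F × F :=
  (-(ρ * ν) * p.1, ν * p.2)

variable {σ : F ≃ₐ[K] F} {ψ : AddChar K ℂ} {p : F × F} {ν ρ : F}

theorem two_ne_zero_of_algebra (K : Type*) {F : Type*} [Field K] [Field F] [Algebra K F]
    (h2 : (2 : K) ≠ 0) : (2 : F) ≠ 0 := by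
  rw [← map_ofNat (algebraMap K F) 2]
  exact (map_ne_zero (algebraMap K F)).2 h2

theorem twistedForm_isSymm : (twistedForm σ p).IsSymm :=
  ⟨fun x y => by
    simp only [twistedForm, LinearMap.mk₂_apply]
    congr 1; ring⟩

theorem twistedForm_self (h2 : (2 : K) ≠ 0) (x : F) :
    twistedForm σ p x x = Algebra.trace K F (p.1 * (x * σ x) + p.2 * x ^ 2) := by
  have := two_ne_zero_of_algebra (F := F) K h2
  simp only [twistedForm, LinearMap.mk₂_apply]
  congr 1; field_simp; ring

theorem trace_apply_symm_mul (x y : F) :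
    Algebra.trace K F (σ.symm x * y) = Algebra.trace K F (x * σ y) := by
  rw [← Algebra.trace_eq_of_algEquiv σ, map_mul, AlgEquiv.apply_symm_apply]

theorem twistedSum_substCoeff [Fintype F] {u : F} (hu : u ≠ 0) :
    twistedSum σ ψ (substCoeff σ u p) = twistedSum σ ψ p := by
  unfold twistedSum
  rw [← Equiv.sum_comp (Equiv.mulLeft₀ u hu)
    (fun x => ψ (Algebra.trace K F (p.1 * (x * σ x) + p.2 * x ^ 2)))]
  refine Finset.sum_congr rfl fun x _ => ?_
  congr 2
  simp only [substCoeff, Equiv.mulLeft₀_apply, map_mul]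
  ring

theorem companionCoeff_substCoeff (u : F) :
    companionCoeff ν ρ (substCoeff σ u p) = substCoeff σ u (companionCoeff ν ρ p) := by
  simp only [companionCoeff, substCoeff, Prod.mk.injEq]
  constructor <;> ring

theorem companionCoeff_smul (c : K) :
    companionCoeff ν ρ (c • p) = c • companionCoeff ν ρ p := by
  simp only [companionCoeff, Prod.smul_mk, Prod.smul_fst, Prod.smul_snd, mul_smul_comm]

/-- Taking companions twice amounts to substituting `ν x` for `x`. -/
theorem companionCoeff_companionCoeff (hρ : ρ ^ 2 * ν = σ ν) :
    companionCoeff ν ρ (companionCoeff ν ρ p) = substCoeff σ ν p := by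
  simp only [companionCoeff, substCoeff, ← hρ, Prod.mk.injEq]
  constructor <;> ring

section Finite

variable [Fintype F]

theorem twistedSum_eq (h2 : (2 : K) ≠ 0) :
    twistedSum σ ψ p = ∑ x, ψ (twistedForm σ p x x) := by
  simp only [twistedSum, twistedForm_self h2]

theorem twistedSum_smul (h2 : (2 : K) ≠ 0) (c : K) :
    twistedSum σ ψ (c • p) = ∑ x, ψ (c * twistedForm σ p x x) := by
  unfold twistedSum
  refine Finset.sum_congr rfl fun x _ => ?_
  rw [twistedForm_self h2, ← smul_eq_mul c, ← map_smul]
  congr 2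
  simp only [Prod.smul_fst, Prod.smul_snd, smul_add, smul_mul_assoc]

theorem twistedSum_neg (hi : IsSquare (-1 : K)) :
    twistedSum σ ψ (-p) = twistedSum σ ψ p := by
  obtain ⟨i, hi⟩ := hi
  have hi0 : algebraMap K F i ≠ 0 := by
    intro h
    have : i = 0 := by simpa using h
    rw [this] at hi
    simp at hi
  rw [← twistedSum_substCoeff (p := p) hi0]
  congr 1
  have : algebraMap K F i * algebraMap K F i = -1 := by rw [← map_mul, ← hi]; simp
  simp only [substCoeff, AlgEquiv.commutes, this, sq]
  ext <;> simp

theorem twistedSum_sq (hψ : ψ ≠ 1) (h2 : (2 : K) ≠ 0) (hi : IsSquare (-1 : K)) :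
    twistedSum σ ψ p ^ 2 = Fintype.card F * Nat.card (twistedRadical σ p) := by
  have h := sum_form_mul_sum_neg_form hψ h2 (twistedForm_isSymm (σ := σ) (p := p))
  have h' := twistedSum_smul (ψ := ψ) (σ := σ) (p := p) h2 (-1)
  rw [neg_one_smul, twistedSum_neg hi] at h'
  simp only [neg_mul, one_mul] at h'
  rw [← h', ← twistedSum_eq h2, ← sq] at h
  exact h

variable [Fintype K]

theorem mem_twistedRadical (h2 : (2 : K) ≠ 0) {x : F} :
    x ∈ twistedRadical σ p ↔ p.1 * σ x + σ.symm (p.1 * x) + 2 * p.2 * x = 0 := by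
  have h2' := two_ne_zero_of_algebra (F := F) K h2
  have key : ∀ y, twistedForm σ p x y = Algebra.traceForm K F
      (2⁻¹ * (p.1 * σ x + σ.symm (p.1 * x) + 2 * p.2 * x)) y := by
    intro y
    rw [Algebra.traceForm_apply]
    have h := trace_apply_symm_mul (σ := σ) (p.1 * x) (σ.symm 2⁻¹ * y)
    simp only [twistedForm, LinearMap.mk₂_apply]
    have e1 : 2⁻¹ * p.1 * (x * σ y + σ x * y) + p.2 * (x * y) =
        p.1 * x * σ (σ.symm 2⁻¹ * y) + (2⁻¹ * p.1 * σ x * y + p.2 * (x * y)) := by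
      rw [map_mul, AlgEquiv.apply_symm_apply]; ring
    have e2 : 2⁻¹ * (p.1 * σ x + σ.symm (p.1 * x) + 2 * p.2 * x) * y =
        σ.symm (p.1 * x) * (σ.symm 2⁻¹ * y) + (2⁻¹ * p.1 * σ x * y + p.2 * (x * y)) := by
      have : σ.symm (2⁻¹ : F) = 2⁻¹ := by rw [map_inv₀, map_ofNat]
      rw [this]; field_simp; ring
    rw [e1, e2, map_add _ (p.1 * x * _), ← h, ← map_add]
  rw [twistedRadical, LinearMap.mem_ker]
  constructor
  · intro h
    have := (traceForm_nondegenerate K F).1 _ fun y => by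
      rw [← key y, h]; rfl
    simpa [h2'] using this
  · intro h
    ext y
    rw [key, h]; simp

theorem mem_twistedRadical_substCoeff (h2 : (2 : K) ≠ 0) {u x : F} (hu : u ≠ 0) :
    x ∈ twistedRadical σ (substCoeff σ u p) ↔ u * x ∈ twistedRadical σ p := by
  rw [mem_twistedRadical h2, mem_twistedRadical h2]
  have : (substCoeff σ u p).1 * σ x + σ.symm ((substCoeff σ u p).1 * x) +
      2 * (substCoeff σ u p).2 * x =
      u * (p.1 * σ (u * x) + σ.symm (p.1 * (u * x)) + 2 * p.2 * (u * x)) := by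
    simp only [substCoeff, map_mul, AlgEquiv.symm_apply_apply]
    ring
  rw [this, mul_eq_zero, or_iff_right hu]

theorem card_twistedRadical_substCoeff (h2 : (2 : K) ≠ 0) {u : F} (hu : u ≠ 0) :
    Nat.card (twistedRadical σ (substCoeff σ u p)) = Nat.card (twistedRadical σ p) :=
  Nat.card_congr ((Equiv.mulLeft₀ u hu).subtypeEquiv fun _ =>
    mem_twistedRadical_substCoeff h2 hu)

theorem one_mem_twistedRadical (h2 : (2 : K) ≠ 0) :
    (1 : F) ∈ twistedRadical σ p ↔ p.2 = -(2⁻¹ * (p.1 + σ.symm p.1)) := by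
  have h2' := two_ne_zero_of_algebra (F := F) K h2
  rw [mem_twistedRadical h2, map_one]
  simp only [mul_one]
  constructor <;> intro h
  · field_simp; linear_combination h
  · rw [h]; field_simp; ring

/-- If `1` lies in the radical, then `y` lies in it exactly when `α (σ(y) - y)` is fixed
by `σ`. -/
theorem mem_twistedRadical_of_one_mem (h2 : (2 : K) ≠ 0) (h1 : (1 : F) ∈ twistedRadical σ p)
    {y : F} : y ∈ twistedRadical σ p ↔ σ (p.1 * (σ y - y)) = p.1 * (σ y - y) := by
  rw [one_mem_twistedRadical h2] at h1
  have h2' := two_ne_zero_of_algebra (F := F) K h2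
  rw [mem_twistedRadical h2, h1, ← map_eq_zero_iff σ σ.injective]
  simp only [map_add, map_mul, map_neg, map_sub, map_inv₀, AlgEquiv.apply_symm_apply, map_ofNat]
  constructor <;> intro h
  · field_simp at h
    linear_combination h
  · field_simp
    linear_combination h

/-- A nonzero pair of coefficients gives a form of corank at most two. -/
theorem exists_card_twistedRadical_eq (h2 : (2 : K) ≠ 0)
    (hσ : ∀ x, σ x = x → ∃ c, algebraMap K F c = x) (hp : p ≠ 0) :
    ∃ j : Fin 3, Nat.card (twistedRadical σ p) = Fintype.card K ^ (j : ℕ) := by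
  have h2' := two_ne_zero_of_algebra (F := F) K h2
  suffices h : ∀ p : F × F, p ≠ 0 → (1 : F) ∈ twistedRadical σ p →
      finrank K (twistedRadical σ p) ≤ 2 by
    by_cases hbot : twistedRadical σ p = ⊥
    · exact ⟨0, by rw [hbot]; simp⟩
    obtain ⟨u, hu, hu0⟩ := Submodule.exists_mem_ne_zero_of_ne_bot hbot
    have hne : substCoeff σ u p ≠ 0 := by
      intro h
      apply hp
      have hσu : σ u ≠ 0 := by simpa using hu0
      simp only [substCoeff, Prod.mk_eq_zero, mul_eq_zero, hu0, hσu, or_false,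
        pow_eq_zero_iff two_ne_zero] at h
      exact Prod.ext h.1 h.2
    have := h _ hne ((mem_twistedRadical_substCoeff h2 hu0).2 (by rwa [mul_one]))
    refine ⟨⟨finrank K (twistedRadical σ (substCoeff σ u p)), by omega⟩, ?_⟩
    rw [← card_twistedRadical_substCoeff h2 hu0, natCard_eq_pow_finrank (K := K),
      Nat.card_eq_fintype_card]
  intro p hp h1
  have hα : p.1 ≠ 0 := by
    intro h
    apply hp
    have := (one_mem_twistedRadical h2).1 h1
    rw [h] at this
    exact Prod.ext h (by simpa using this)
  have hspan : ∀ x : F, σ x = x → x ∈ K ∙ (1 : F) := by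
    intro x hx
    obtain ⟨c, hc⟩ := hσ x hx
    exact Submodule.mem_span_singleton.2 ⟨c, by rw [← hc, Algebra.smul_def, mul_one]⟩
  let g : F →ₗ[K] F := LinearMap.mulLeft K p.1 ∘ₗ (σ.toLinearMap - LinearMap.id)
  have hg : ∀ y, g y = p.1 * (σ y - y) := fun y => rfl
  let f := g.domRestrict (twistedRadical σ p)
  have hrange : finrank K (LinearMap.range f) ≤ 1 := by
    rw [← finrank_span_singleton (K := K) (one_ne_zero (α := F))]
    apply Submodule.finrank_mono
    rintro _ ⟨y, rfl⟩
    exact hspan _ ((mem_twistedRadical_of_one_mem h2 h1).1 y.2)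
  have hker : finrank K (LinearMap.ker f) ≤ 1 := by
    rw [← finrank_span_singleton (K := K) (one_ne_zero (α := F)),
      ← Submodule.finrank_map_subtype_eq]
    apply Submodule.finrank_mono
    rintro _ ⟨y, hy, rfl⟩
    apply hspan
    have : p.1 * (σ y - y) = 0 := hy
    simpa [hα, sub_eq_zero] using this
  have := LinearMap.finrank_range_add_finrank_ker f
  omega

/-- Since `[F : K]` is odd, scaling by a nonsquare of `K` reverses the sign of the sum exactly when
the corank `j` is even. -/
theorem twistedSum_nonsquare_smul (hψ : ψ ≠ 1) (h2 : (2 : K) ≠ 0) (hn : Odd (finrank K F))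
    {c : K} (hc : ¬IsSquare c) {j : ℕ}
    (hj : Nat.card (twistedRadical σ p) = Fintype.card K ^ j) :
    twistedSum σ ψ (c • p) = (-1) ^ (j + 1) * twistedSum σ ψ p := by
  rw [twistedSum_smul h2, twistedSum_eq h2,
    sum_nonsquare_mul_form hψ h2 twistedForm_isSymm hc hj, pow_add, hn.neg_one_pow, pow_succ,
    mul_comm (-1 : ℂ)]

/-- A form and its companion are never both degenerate. -/
theorem twistedRadical_eq_bot_or (h2 : (2 : K) ≠ 0) (hν : ν ≠ 0) (hρ : ρ ^ 2 * ν = σ ν)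
    (hH : ∀ y, y + ρ * σ y = 0 → y = 0) (hp : p ≠ 0) :
    twistedRadical σ p = ⊥ ∨ twistedRadical σ (companionCoeff ν ρ p) = ⊥ := by
  by_contra! h
  obtain ⟨u, hu, hu0⟩ := Submodule.exists_mem_ne_zero_of_ne_bot h.1
  obtain ⟨z, hz, hz0⟩ := Submodule.exists_mem_ne_zero_of_ne_bot h.2
  have h2' := two_ne_zero_of_algebra (F := F) K h2
  have hρ0 : ρ ≠ 0 := by
    rintro rfl
    rw [zero_pow two_ne_zero, zero_mul, eq_comm] at hρ
    exact hν (by simpa using hρ)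
  -- after substituting `u x` for `x`, the radical of the form contains `1`
  have h1 : (1 : F) ∈ twistedRadical σ (substCoeff σ u p) :=
    (mem_twistedRadical_substCoeff h2 hu0).2 (by rwa [mul_one])
  have hy : z / u ∈ twistedRadical σ (companionCoeff ν ρ (substCoeff σ u p)) := by
    rw [companionCoeff_substCoeff, mem_twistedRadical_substCoeff h2 hu0, mul_div_cancel₀ _ hu0]
    exact hz
  have hα : (substCoeff σ u p).1 ≠ 0 := by
    intro h
    have := (one_mem_twistedRadical h2).1 h1
    rw [h] at this
    have hσu : σ u ≠ 0 := by simpa using hu0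
    simp only [substCoeff, map_zero, add_zero, mul_zero, neg_zero, mul_eq_zero, hu0, hσu, or_false,
      pow_eq_zero_iff two_ne_zero] at this h
    exact hp (Prod.ext h this)
  have hy0 : z / u ≠ 0 := div_ne_zero hz0 hu0
  generalize z / u = y at hy hy0
  generalize substCoeff σ u p = P at h1 hy hα
  rw [one_mem_twistedRadical h2] at h1
  rw [mem_twistedRadical h2, ← map_eq_zero_iff σ σ.injective] at hy
  simp only [companionCoeff, h1, map_add, map_mul, map_neg, map_inv₀, AlgEquiv.apply_symm_apply,
    map_ofNat] at hy
  -- with `E = y + ρ σ(y)`, the radical equation reads `α E + ρ σ(α E) = 0`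
  have hE : P.1 * (y + ρ * σ y) = 0 := by
    apply hH
    simp only [map_add, map_mul]
    have : ρ * ν * (P.1 * (y + ρ * σ y) + ρ * (σ P.1 * (σ y + σ ρ * σ (σ y)))) = 0 := by
      rw [← hρ] at hy
      field_simp at hy
      linear_combination -hy
    simpa [hρ0, hν] using this
  exact hy0 (hH y (by simpa [hα] using hE))

end Finite

end TwistedForm

/-! ### Moments of the character sums -/

section Moments

open Module

theorem sq_add_mul_sq_eq_zero {F : Type*} [Field F] {ν : F} (hν : ¬IsSquare (-ν)) {u v : F} :
    u ^ 2 + ν * v ^ 2 = 0 ↔ u = 0 ∧ v = 0 := by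
  constructor
  · intro h
    have hv : v = 0 := by
      by_contra hv
      apply hν
      refine ⟨u / v, ?_⟩
      field_simp
      linear_combination -h
    refine ⟨?_, hv⟩
    simpa [hv] using h
  · rintro ⟨rfl, rfl⟩
    simp

variable {K F : Type*} [Field K] [Field F] [Fintype F] [Algebra K F]
  {σ : F ≃ₐ[K] F} {ψ : AddChar K ℂ} {ν ρ : F}

theorem sum_addChar_trace_mul (hψ : ψ ≠ 1) [Fintype K] [DecidableEq F] (a : F) :
    ∑ x : F, ψ (Algebra.trace K F (x * a)) = if a = 0 then (Fintype.card F : ℂ) else 0 := by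
  split_ifs with h
  · simp [h]
  · have hf : Algebra.traceForm K F a ≠ 0 := by
      intro h0
      exact h ((traceForm_nondegenerate K F).1 a fun y => by rw [h0]; rfl)
    have := sum_addChar_linearMap_eq_zero hψ hf
    simpa only [Algebra.traceForm_apply, mul_comm a] using this

theorem sum_addChar_trace_pair (hψ : ψ ≠ 1) [Fintype K] [DecidableEq F] (a b : F) :
    ∑ p : F × F, ψ (Algebra.trace K F (p.1 * a + p.2 * b)) =
      if a = 0 ∧ b = 0 then (Fintype.card F : ℂ) ^ 2 else 0 := by
  simp only [Fintype.sum_prod_type, map_add, AddChar.map_add_eq_mul, ← Finset.mul_sum,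
    ← Finset.sum_mul, sum_addChar_trace_mul hψ]
  by_cases ha : a = 0 <;> by_cases hb : b = 0 <;> simp [ha, hb, sq]

theorem twistedSum_mul_companion (p : F × F) :
    twistedSum σ ψ p * twistedSum σ ψ (companionCoeff ν ρ p) =
      ∑ u, ∑ v, ψ (Algebra.trace K F (p.1 * (u * σ u - ρ * ν * (v * σ v)) +
        p.2 * (u ^ 2 + ν * v ^ 2))) := by
  simp only [twistedSum, Finset.sum_mul_sum, ← AddChar.map_add_eq_mul, ← map_add, companionCoeff]
  refine Finset.sum_congr rfl fun u _ => Finset.sum_congr rfl fun v _ => ?_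
  congr 2
  ring

variable [Fintype K]

theorem sum_twistedSum (hψ : ψ ≠ 1) :
    ∑ p : F × F, twistedSum σ ψ p = (Fintype.card F : ℂ) ^ 2 := by
  classical
  unfold twistedSum
  rw [Finset.sum_comm]
  simp only [sum_addChar_trace_pair hψ]
  rw [Finset.sum_eq_single 0]
  · simp
  · intro x _ hx
    simp [hx]
  · simp

/-- Only `(u, v) = (0, 0)` contributes, since `-ν` is not a square. -/
theorem sum_twistedSum_mul_companion (hψ : ψ ≠ 1) (hν : ¬IsSquare (-ν)) :
    ∑ p : F × F, twistedSum σ ψ p * twistedSum σ ψ (companionCoeff ν ρ p) =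
      (Fintype.card F : ℂ) ^ 2 := by
  classical
  simp only [twistedSum_mul_companion]
  rw [Finset.sum_comm]
  simp only [Finset.sum_comm (s := (Finset.univ : Finset (F × F))), sum_addChar_trace_pair hψ,
    sq_add_mul_sq_eq_zero hν]
  rw [Finset.sum_eq_single 0, Finset.sum_eq_single 0]
  · simp
  · intro x _ hx
    simp [hx]
  · simp
  · intro x _ hx
    simp [hx]
  · simp

/-- A sum weighted by the size of the radical reduces, by the substitutions `x ↦ u x`, to the
coefficients whose radical contains `1`. -/
theorem sum_card_twistedRadical_mul (h2 : (2 : K) ≠ 0) {f : F × F → ℂ}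
    (hf : ∀ u p, u ≠ 0 → f (substCoeff σ u p) = f p) :
    ∑ p, (Nat.card (twistedRadical σ p) : ℂ) * f p =
      ∑ p, f p + (Fintype.card F - 1) * ∑ α, f (α, -(2⁻¹ * (α + σ.symm α))) := by
  classical
  have hcard : ∀ p, (Nat.card (twistedRadical σ p) : ℂ) * f p =
      ∑ x : F, if x ∈ twistedRadical σ p then f p else 0 := by
    intro p
    rw [← Finset.sum_filter, Finset.sum_const, nsmul_eq_mul, Nat.card_eq_fintype_card,
      Fintype.card_subtype]
  have hone : ∑ p, (if (1 : F) ∈ twistedRadical σ p then f p else 0) =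
      ∑ α, f (α, -(2⁻¹ * (α + σ.symm α))) := by
    simp only [one_mem_twistedRadical h2, Fintype.sum_prod_type]
    simp
  have hu : ∀ u : F, u ≠ 0 → ∑ p, (if u ∈ twistedRadical σ p then f p else 0) =
      ∑ α, f (α, -(2⁻¹ * (α + σ.symm α))) := by
    intro u hu0
    rw [← hone]
    have hσu : σ u ≠ 0 := by simpa using hu0
    let e : F × F ≃ F × F := (Equiv.mulRight₀ (u * σ u) (mul_ne_zero hu0 hσu)).prodCongr
      (Equiv.mulRight₀ (u ^ 2) (pow_ne_zero 2 hu0))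
    rw [← Equiv.sum_comp e fun p => if (1 : F) ∈ twistedRadical σ p then f p else 0]
    refine Finset.sum_congr rfl fun p _ => ?_
    change _ = if (1 : F) ∈ twistedRadical σ (substCoeff σ u p) then f (substCoeff σ u p) else 0
    simp only [mem_twistedRadical_substCoeff h2 hu0, mul_one, hf u p hu0]
  simp only [hcard]
  rw [Finset.sum_comm, ← Finset.add_sum_erase _ _ (Finset.mem_univ 0)]
  congr 1
  · simp
  · rw [Finset.sum_congr rfl fun u h => hu u (Finset.ne_of_mem_erase h), Finset.sum_const,
      Finset.card_erase_of_mem (Finset.mem_univ _), nsmul_eq_mul, Finset.card_univ,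
      Nat.cast_sub Fintype.card_pos, Nat.cast_one]

theorem sum_card_twistedRadical (h2 : (2 : K) ≠ 0) :
    ∑ p : F × F, (Nat.card (twistedRadical σ p) : ℂ) =
      (Fintype.card F : ℂ) ^ 2 + (Fintype.card F - 1) * Fintype.card F := by
  have := sum_card_twistedRadical_mul (σ := σ) h2 (f := fun _ => 1) fun _ _ _ => rfl
  simpa [sq] using this

theorem card_fixed (hσ : ∀ x, σ x = x → ∃ c, algebraMap K F c = x) [DecidableEq F] :
    (Finset.univ.filter fun x : F => σ x = x).card = Fintype.card K := by
  rw [← Finset.card_univ, ← Finset.card_image_of_injective Finset.univ (algebraMap K F).injective]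
  congr 1
  ext x
  simp only [Finset.mem_filter, Finset.mem_univ, true_and, Finset.mem_image]
  constructor
  · exact hσ x
  · rintro ⟨c, rfl⟩
    exact σ.commutes c

theorem sum_card_twistedRadical_sq (h2 : (2 : K) ≠ 0)
    (hσ : ∀ x, σ x = x → ∃ c, algebraMap K F c = x) :
    ∑ p : F × F, (Nat.card (twistedRadical σ p) : ℂ) ^ 2 =
      (Fintype.card F : ℂ) ^ 2 + (Fintype.card F - 1) * Fintype.card F +
        (Fintype.card F - 1) * (Fintype.card K * (2 * Fintype.card F - Fintype.card K)) := by
  classical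
  have := sum_card_twistedRadical_mul (σ := σ) h2
    (f := fun p => (Nat.card (twistedRadical σ p) : ℂ))
    fun u p hu => by rw [card_twistedRadical_substCoeff h2 hu]
  simp only [sq] at this ⊢
  rw [this, sum_card_twistedRadical h2, sq]
  congr 2
  have h1 : ∀ α : F, (1 : F) ∈ twistedRadical σ (α, -(2⁻¹ * (α + σ.symm α))) := fun α =>
    (one_mem_twistedRadical h2).2 rfl
  have hcard : ∀ α : F, (Nat.card (twistedRadical σ (α, -(2⁻¹ * (α + σ.symm α)))) : ℂ) =
      ∑ y, if σ (α * (σ y - y)) = α * (σ y - y) then 1 else 0 := by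
    intro α
    rw [Finset.sum_boole, Nat.card_eq_fintype_card, Fintype.card_subtype]
    simp only [mem_twistedRadical_of_one_mem h2 (h1 α)]
  simp only [hcard]
  rw [Finset.sum_comm]
  have hy : ∀ y : F, (∑ α, if σ (α * (σ y - y)) = α * (σ y - y) then (1 : ℂ) else 0) =
      (Fintype.card K : ℂ) + if σ y = y then (Fintype.card F : ℂ) - Fintype.card K else 0 := by
    intro y
    split_ifs with h
    · simp [h]
    · have hne : σ y - y ≠ 0 := sub_ne_zero.2 h
      have := Equiv.sum_comp (Equiv.mulRight₀ (σ y - y) hne)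
        fun x => if σ x = x then (1 : ℂ) else 0
      simp only [Equiv.mulRight₀_apply] at this
      rw [this, Finset.sum_boole, card_fixed hσ, add_zero]
  simp only [hy, Finset.sum_add_distrib]
  rw [← Finset.sum_filter, Finset.sum_const, Finset.sum_const, card_fixed hσ, Finset.card_univ]
  simp only [nsmul_eq_mul]
  ring

theorem sum_card_twistedRadical_mul_companion (hψ : ψ ≠ 1) (h2 : (2 : K) ≠ 0)
    (hσ : ∀ x, σ x = x → ∃ c, algebraMap K F c = x) (hν : ¬IsSquare (-ν)) (hρ : ρ ^ 2 * ν = σ ν)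
    (hH : ∀ y, y + ρ * σ y = 0 → y = 0) :
    ∑ p : F × F, (Nat.card (twistedRadical σ p) : ℂ) *
        (twistedSum σ ψ p * twistedSum σ ψ (companionCoeff ν ρ p)) =
      (Fintype.card F : ℂ) ^ 2 + (Fintype.card F - 1) * (Fintype.card F * Fintype.card K) := by
  classical
  have h2' := two_ne_zero_of_algebra (F := F) K h2
  rw [sum_card_twistedRadical_mul h2
    (f := fun p => twistedSum σ ψ p * twistedSum σ ψ (companionCoeff ν ρ p))
    fun u p hu => by rw [companionCoeff_substCoeff, twistedSum_substCoeff hu,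
      twistedSum_substCoeff hu], sum_twistedSum_mul_companion hψ hν]
  congr 2
  simp only [twistedSum_mul_companion]
  -- the sum over `α` detects the zeros of a binary quadratic form without nontrivial zeros
  have hα : ∀ u v α : F, Algebra.trace K F (α * (u * σ u - ρ * ν * (v * σ v)) +
      -(2⁻¹ * (α + σ.symm α)) * (u ^ 2 + ν * v ^ 2)) =
      Algebra.trace K F (α * -(2⁻¹ * ((σ u - u) ^ 2 + ν * (v + ρ * σ v) ^ 2))) := by
    intro u v α
    have h := trace_apply_symm_mul (σ := σ) α (2⁻¹ * (u ^ 2 + ν * v ^ 2))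
    have e1 : α * (u * σ u - ρ * ν * (v * σ v)) +
        -(2⁻¹ * (α + σ.symm α)) * (u ^ 2 + ν * v ^ 2) =
        (α * (u * σ u - ρ * ν * (v * σ v)) - 2⁻¹ * α * (u ^ 2 + ν * v ^ 2)) -
          σ.symm α * (2⁻¹ * (u ^ 2 + ν * v ^ 2)) := by ring
    rw [e1, map_sub, h, ← map_sub]
    congr 1
    simp only [map_add, map_mul, map_inv₀, map_ofNat, map_pow, ← hρ]
    field_simp
    ring
  have hzero : ∀ u v : F, -(2⁻¹ * ((σ u - u) ^ 2 + ν * (v + ρ * σ v) ^ 2)) = 0 ↔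
      σ u = u ∧ v = 0 := by
    intro u v
    rw [neg_eq_zero, mul_eq_zero, or_iff_right (inv_ne_zero h2'), sq_add_mul_sq_eq_zero hν,
      sub_eq_zero]
    refine and_congr_right fun _ => ⟨hH v, ?_⟩
    rintro rfl
    simp
  have hu : ∀ u : F, (∑ α : F, ∑ v : F, ψ (Algebra.trace K F
      (α * -(2⁻¹ * ((σ u - u) ^ 2 + ν * (v + ρ * σ v) ^ 2))))) =
      if σ u = u then (Fintype.card F : ℂ) else 0 := by
    intro u
    rw [Finset.sum_comm]
    simp only [sum_addChar_trace_mul hψ, hzero, ite_and]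
    split_ifs <;> simp
  simp only [hα]
  rw [Finset.sum_comm]
  simp only [hu]
  rw [← Finset.sum_filter, Finset.sum_const, card_fixed hσ, nsmul_eq_mul, mul_comm]

end Moments

/-! ### Pairs of signed powers and their joint distribution -/

section SignedPowers

/-- The integer `± a ^ j` encoded by a sign and an exponent `j ≤ 2`. -/
def signedPow (a : ℕ) (c : Bool × Fin 3) : ℤ :=
  (if c.1 then 1 else -1) * (a : ℤ) ^ (c.2 : ℕ)

/-- Reverses the sign of `± a ^ j` for even `j` only. -/
def flipEven (c : Bool × Fin 3) : Bool × Fin 3 :=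
  (if c.2 = 1 then c.1 else !c.1, c.2)

theorem signedPow_injective {a : ℕ} (ha : 1 < a) : Function.Injective (signedPow a) := by
  have hpos : ∀ n : ℕ, 0 < (a : ℤ) ^ n := fun n => by positivity
  have hinj : ∀ m n : ℕ, (a : ℤ) ^ m = (a : ℤ) ^ n → m = n := fun m n h =>
    Nat.pow_right_injective ha (by exact_mod_cast h)
  rintro ⟨s, i⟩ ⟨t, j⟩ h
  have hi := hpos i
  have hj := hpos j
  have hh := hinj i j
  cases s <;> cases t <;> simp only [signedPow, Bool.false_eq_true, if_false, if_true] at h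
  · exact Prod.ext rfl (Fin.ext (hh (by linarith)))
  · linarith
  · linarith
  · exact Prod.ext rfl (Fin.ext (hh (by linarith)))

theorem signedPow_flipEven (a : ℕ) (c : Bool × Fin 3) :
    signedPow a (flipEven c) = (-1) ^ ((c.2 : ℕ) + 1) * signedPow a c := by
  obtain ⟨s, j⟩ := c
  fin_cases j <;> cases s <;> simp [signedPow, flipEven]

theorem flipEven_flipEven (c : Bool × Fin 3) : flipEven (flipEven c) = c := by
  revert c; decide

variable {k : Type*} [Field k] [CharZero k] {a : ℕ} {b e : k}
  {N : Bool × Fin 3 → Bool × Fin 3 → k}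

/-- The symmetries leave six independent frequencies. Below, `N c c'` counts the pairs whose first
member is `c` and whose second member is `c'`. -/
theorem sum_signedPow_symm {R : Type*} [CommRing R] {N : Bool × Fin 3 → Bool × Fin 3 → R}
    (hswap : ∀ c c', N c c' = N c' c) (hflip : ∀ c c', N (flipEven c) (flipEven c') = N c c')
    (hdeg : ∀ c c', c.2 ≠ 0 → c'.2 ≠ 0 → N c c' = 0) (g : ℤ → ℤ → R) :
    ∑ c, ∑ c', N c c' * g (signedPow a c) (signedPow a c') =
      N (true, 0) (true, 0) * (g 1 1 + g (-1) (-1)) +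
      N (true, 0) (false, 0) * (g 1 (-1) + g (-1) 1) +
      N (true, 1) (true, 0) * (g a 1 + g a (-1) + g 1 a + g (-1) a) +
      N (false, 1) (true, 0) * (g (-a) 1 + g (-a) (-1) + g 1 (-a) + g (-1) (-a)) +
      N (true, 2) (true, 0) * (g (a ^ 2) 1 + g (-a ^ 2) (-1) + g 1 (a ^ 2) + g (-1) (-a ^ 2)) +
      N (true, 2) (false, 0) * (g (a ^ 2) (-1) + g (-a ^ 2) 1 + g (-1) (a ^ 2) +
        g 1 (-a ^ 2)) := by
  have e1 : N (false, 0) (false, 0) = N (true, 0) (true, 0) := hflip (true, 0) (true, 0)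
  have e2 : N (false, 0) (true, 0) = N (true, 0) (false, 0) := hswap _ _
  have e3 : N (true, 1) (false, 0) = N (true, 1) (true, 0) := hflip (true, 1) (true, 0)
  have e4 : N (true, 0) (true, 1) = N (true, 1) (true, 0) := hswap _ _
  have e5 : N (false, 0) (true, 1) = N (true, 1) (true, 0) := by rw [hswap, e3]
  have e6 : N (false, 1) (false, 0) = N (false, 1) (true, 0) := hflip (false, 1) (true, 0)
  have e7 : N (true, 0) (false, 1) = N (false, 1) (true, 0) := hswap _ _
  have e8 : N (false, 0) (false, 1) = N (false, 1) (true, 0) := by rw [hswap, e6]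
  have e9 : N (false, 2) (false, 0) = N (true, 2) (true, 0) := hflip (true, 2) (true, 0)
  have e10 : N (true, 0) (true, 2) = N (true, 2) (true, 0) := hswap _ _
  have e11 : N (false, 0) (false, 2) = N (true, 2) (true, 0) := by rw [hswap, e9]
  have e12 : N (false, 2) (true, 0) = N (true, 2) (false, 0) := hflip (true, 2) (false, 0)
  have e13 : N (false, 0) (true, 2) = N (true, 2) (false, 0) := hswap _ _
  have e14 : N (true, 0) (false, 2) = N (true, 2) (false, 0) := by rw [hswap, e12]
  have z11 : ∀ s t, N (s, 1) (t, 1) = 0 := fun s t => hdeg _ _ (by simp) (by simp)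
  have z12 : ∀ s t, N (s, 1) (t, 2) = 0 := fun s t => hdeg _ _ (by simp) (by simp)
  have z21 : ∀ s t, N (s, 2) (t, 1) = 0 := fun s t => hdeg _ _ (by simp) (by simp)
  have z22 : ∀ s t, N (s, 2) (t, 2) = 0 := fun s t => hdeg _ _ (by simp) (by simp)
  have v0 : signedPow a (true, 0) = 1 := by simp [signedPow]
  have v0' : signedPow a (false, 0) = -1 := by simp [signedPow]
  have v1 : signedPow a (true, 1) = a := by simp [signedPow]
  have v1' : signedPow a (false, 1) = -a := by simp [signedPow]
  have v2 : signedPow a (true, 2) = a ^ 2 := by simp [signedPow]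
  have v2' : signedPow a (false, 2) = -a ^ 2 := by simp [signedPow]
  simp only [Fintype.sum_prod_type, Fintype.sum_bool, Fin.sum_univ_three, v0, v0', v1, v1', v2,
    v2', e1, e2, e3, e4, e5, e6, e7, e8, e9, e10, e11, e12, e13, e14, z11, z12, z21, z22]
  ring

/-- The symmetries and the moments determine the joint distribution of two values `± a ^ j`. -/
theorem joint_distribution_of_moments (ha : 1 < a) (hb : b = a * e)
    (hswap : ∀ c c', N c c' = N c' c) (hflip : ∀ c c', N (flipEven c) (flipEven c') = N c c')
    (hdeg : ∀ c c', c.2 ≠ 0 → c'.2 ≠ 0 → N c c' = 0)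
    (M0 : ∑ c, ∑ c', N c c' = b ^ 4 - 1)
    (M1 : ∑ c, ∑ c', N c c' * signedPow a c = b * (b ^ 2 - 1))
    (M2 : ∑ c, ∑ c', N c c' * signedPow a c ^ 2 = b ^ 4 + (b ^ 2 - 1) * b ^ 2 - b ^ 2)
    (M4 : ∑ c, ∑ c', N c c' * signedPow a c ^ 4 =
      b ^ 4 + (b ^ 2 - 1) * b ^ 2 + (b ^ 2 - 1) * (a ^ 2 * (2 * b ^ 2 - a ^ 2)) - b ^ 4)
    (M11 : ∑ c, ∑ c', N c c' * (signedPow a c * signedPow a c') = 0)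
    (M31 : ∑ c, ∑ c', N c c' * (signedPow a c ^ 3 * signedPow a c') =
      b ^ 2 + (b ^ 2 - 1) * a ^ 2 - b ^ 4) :
    N (true, 0) (true, 0) = 1 / 4 * (a ^ 2 - 1) * (b ^ 4 - 1) / (a ^ 2 + 1) ∧
    2 * N (true, 0) (false, 0) =
      1 / 2 * (a ^ 2 * b ^ 2 - 3 * b ^ 2 + a ^ 2 + 1) * (b ^ 2 - 1) / (a ^ 2 - 1) ∧
    2 * N (true, 1) (true, 0) = 1 / 2 * e * (e + 1) * (b ^ 2 - 1) ∧
    2 * N (false, 1) (true, 0) = 1 / 2 * e * (e - 1) * (b ^ 2 - 1) ∧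
    N (true, 2) (true, 0) = 0 ∧
    2 * N (true, 2) (false, 0) = (e ^ 2 - 1) * (b ^ 2 - 1) / (a ^ 4 - 1) := by
  have key := sum_signedPow_symm (a := a) hswap hflip hdeg
  have m0 := key fun _ _ => 1
  have m1 := key fun x _ => x
  have m2 := key fun x _ => x ^ 2
  have m4 := key fun x _ => x ^ 4
  have m11 := key fun x y => x * y
  have m31 := key fun x y => x ^ 3 * y
  simp only [mul_one] at m0
  rw [M0] at m0
  rw [M1] at m1
  rw [M2] at m2
  rw [M4] at m4
  rw [M11] at m11
  rw [M31] at m31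
  clear key M0 M1 M2 M4 M11 M31 hswap hflip hdeg
  push_cast at m0 m1 m2 m4 m11 m31
  generalize N (true, 0) (true, 0) = x₁ at *
  generalize N (true, 0) (false, 0) = x₂ at *
  generalize N (true, 1) (true, 0) = y₁ at *
  generalize N (false, 1) (true, 0) = y₂ at *
  generalize N (true, 2) (true, 0) = z₁ at *
  generalize N (true, 2) (false, 0) = z₂ at *
  have ha0 : (a : k) ≠ 0 := by exact_mod_cast (by omega : a ≠ 0)
  have hd : (a : k) ^ 2 - 1 ≠ 0 := by
    have h1 : (a : k) ^ 2 ≠ 1 := by exact_mod_cast (Nat.one_lt_pow two_ne_zero ha).ne'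
    exact sub_ne_zero.2 h1
  have hs : (a : k) ^ 2 + 1 ≠ 0 := by exact_mod_cast (by positivity : a ^ 2 + 1 ≠ 0)
  have hds : (a : k) ^ 4 - 1 ≠ 0 := by
    rw [show (a : k) ^ 4 - 1 = (a ^ 2 - 1) * (a ^ 2 + 1) by ring]
    exact mul_ne_zero hd hs
  generalize (a : k) = a at *
  subst hb
  -- `∑ (r - 1) (r - a²)` over the radical sizes `r` isolates corank two
  have hZ : 2 * (z₁ + z₂) * (a ^ 4 - 1) = ((a * e) ^ 2 - 1) * (e ^ 2 - 1) := by
    refine mul_left_cancel₀ (mul_ne_zero (pow_ne_zero 2 ha0) hd) ?_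
    linear_combination -m4 + (1 + a ^ 2) * m2 - a ^ 2 * m0
  -- the two mixed moments give the difference, and `z₁ + z₂ = -(z₁ - z₂)` forces `z₁ = 0`
  have hD : 2 * (z₁ - z₂) * (a ^ 4 - 1) = -(((a * e) ^ 2 - 1) * (e ^ 2 - 1)) := by
    refine mul_left_cancel₀ (pow_ne_zero 2 ha0) ?_
    linear_combination -m31 + m11
  have hz₁ : z₁ = 0 := by
    have : z₁ * (4 * (a ^ 4 - 1)) = 0 := by linear_combination hZ + hD
    simpa [hds] using this
  subst hz₁
  have hY : 2 * (y₁ + y₂) = ((a * e) ^ 2 - 1) * e ^ 2 := by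
    refine mul_left_cancel₀ hd ?_
    linear_combination -m2 + m0 - hZ
  have hW : 2 * (y₁ - y₂) = e * ((a * e) ^ 2 - 1) := by
    refine mul_left_cancel₀ ha0 ?_
    linear_combination -m1
  have hz₂ : 2 * z₂ = (e ^ 2 - 1) * ((a * e) ^ 2 - 1) / (a ^ 4 - 1) := by
    rw [eq_div_iff hds]
    linear_combination hZ
  refine ⟨?_, ?_, ?_, ?_, rfl, hz₂⟩
  · rw [eq_div_iff hs]
    linear_combination (a ^ 2 + 1) / 4 * (-m0 - m11) - (a ^ 2 + 1) / 2 * hY + hZ / 2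
  · rw [eq_div_iff hd]
    linear_combination (a ^ 2 - 1) / 2 * (-m0 + m11) - (a ^ 2 - 1) * hY - hZ
  · linear_combination (hY + hW) / 2
  · linear_combination (hY - hW) / 2

end SignedPowers

/-! ### The distribution of the sum of a character sum and its companion -/

section Distribution

open Module

theorem sum_comp_pair_eq_sum_card_mul {α ι R : Type*} [Fintype ι] [DecidableEq ι] [CommRing R]
    (X : Finset α) (f f' : α → ι) (g : ι → ι → R) :
    ∑ x ∈ X, g (f x) (f' x) =
      ∑ c, ∑ c', ((X.filter fun x => f x = c ∧ f' x = c').card : R) * g c c' := by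
  rw [← Fintype.sum_prod_type'
    (f := fun c c' => ((X.filter fun x => f x = c ∧ f' x = c').card : R) * g c c'),
    ← Finset.sum_fiberwise X (fun x => (f x, f' x))]
  refine Finset.sum_congr rfl fun c _ => ?_
  rw [← nsmul_eq_mul, ← Finset.sum_const]
  refine Finset.sum_congr (by ext; simp [Prod.ext_iff]) fun x hx => ?_
  simp only [Finset.mem_filter] at hx
  rw [hx.2.1, hx.2.2]

variable {K F : Type*} [Field K] [Field F] [Fintype F] [Algebra K F]
  {σ : F ≃ₐ[K] F} {ψ : AddChar K ℂ} {ν ρ : F}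

theorem companionCoeff_zero {F : Type*} [Field F] {ν ρ : F} : companionCoeff ν ρ 0 = 0 := by
  ext <;> simp [companionCoeff]

theorem companionCoeff_injective {F : Type*} [Field F] {ν ρ : F} (hν : ν ≠ 0) (hρ : ρ ≠ 0) :
    Function.Injective (companionCoeff ν ρ) := by
  rintro ⟨α, β⟩ ⟨α', β'⟩ h
  simpa [companionCoeff, hν, hρ] using h

theorem twistedSum_zero : twistedSum σ ψ 0 = Fintype.card F := by
  simp [twistedSum]

/-- The values and frequencies of the sum of a twisted quadratic character sum and its companion,
where the two fields have `a²` and `b² = (a e)²` elements. -/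
noncomputable def pairTable (a b e : ℕ) : List (ℂ × ℚ) :=
  [ (2 * (b : ℂ) ^ 2, 1),
    (0, 1 / 2 * ((a : ℚ) ^ 2 * b ^ 2 - 3 * b ^ 2 + a ^ 2 + 1) * (b ^ 2 - 1) / (a ^ 2 - 1)),
    (((a : ℂ) ^ 2 - 1) * b, ((e : ℚ) ^ 2 - 1) * (b ^ 2 - 1) / (a ^ 4 - 1)),
    (-((a : ℂ) ^ 2 - 1) * b, ((e : ℚ) ^ 2 - 1) * (b ^ 2 - 1) / (a ^ 4 - 1)),
    ((1 - (a : ℂ)) * b, 1 / 2 * (e : ℚ) * (e - 1) * (b ^ 2 - 1)),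
    ((-1 - (a : ℂ)) * b, 1 / 2 * (e : ℚ) * (e - 1) * (b ^ 2 - 1)),
    ((1 + (a : ℂ)) * b, 1 / 2 * (e : ℚ) * (e + 1) * (b ^ 2 - 1)),
    ((-1 + (a : ℂ)) * b, 1 / 2 * (e : ℚ) * (e + 1) * (b ^ 2 - 1)),
    (2 * (b : ℂ), 1 / 4 * ((a : ℚ) ^ 2 - 1) * (b ^ 4 - 1) / (a ^ 2 + 1)),
    (-2 * (b : ℂ), 1 / 4 * ((a : ℚ) ^ 2 - 1) * (b ^ 4 - 1) / (a ^ 2 + 1)) ]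

variable [Fintype K]

/-- For nonzero coefficients the sum is `± b a ^ j`, where `j` is the corank of the form. -/
theorem exists_twistedSum_eq (hψ : ψ ≠ 1) (h2 : (2 : K) ≠ 0) (hi : IsSquare (-1 : K))
    (hσ : ∀ x, σ x = x → ∃ c, algebraMap K F c = x) {a b : ℕ}
    (hK : Fintype.card K = a ^ 2) (hF : Fintype.card F = b ^ 2) {p : F × F} (hp : p ≠ 0) :
    ∃ c, twistedSum σ ψ p = b * signedPow a c ∧
      Nat.card (twistedRadical σ p) = Fintype.card K ^ (c.2 : ℕ) := by
  obtain ⟨j, hj⟩ := exists_card_twistedRadical_eq h2 hσ hp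
  have hsq : twistedSum σ ψ p ^ 2 = (b * (a : ℂ) ^ (j : ℕ)) ^ 2 := by
    rw [twistedSum_sq hψ h2 hi, hj, hF, hK]
    push_cast
    ring
  rcases sq_eq_sq_iff_eq_or_eq_neg.1 hsq with h | h
  · exact ⟨(true, j), by rw [h]; simp [signedPow], hj⟩
  · exact ⟨(false, j), by rw [h]; simp [signedPow], hj⟩

/-- The value distribution of `T + T'` in the general setting. The hypothesis `hH` says that no
nonzero element of `s F`, where `s² = ν` and `σ(s) = ρ s`, is negated by `σ`. -/
theorem ncard_twistedSum_add_companion (hψ : ψ ≠ 1) (h2 : (2 : K) ≠ 0) (hi : IsSquare (-1 : K))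
    (hσ : ∀ x, σ x = x → ∃ c, algebraMap K F c = x) (hn : Odd (finrank K F))
    (hν : ¬IsSquare (-ν)) (hρ : ρ ^ 2 * ν = σ ν) (hH : ∀ y, y + ρ * σ y = 0 → y = 0)
    {a b e : ℕ} (ha : 1 < a) (hK : Fintype.card K = a ^ 2) (hF : Fintype.card F = b ^ 2)
    (hb : b = a * e) (v : ℂ) :
    (({p : F × F | twistedSum σ ψ p + twistedSum σ ψ (companionCoeff ν ρ p) = v}.ncard : ℕ) : ℚ) =
      totalFrequency (pairTable a b e) v := by
  classical
  have hν0 : ν ≠ 0 := by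
    rintro rfl
    simp at hν
  have hρ0 : ρ ≠ 0 := by
    rintro rfl
    rw [zero_pow two_ne_zero, zero_mul, eq_comm] at hρ
    exact hν0 (by simpa using hρ)
  have hb0 : (b : ℂ) ≠ 0 := by
    intro h
    have : b = 0 := by exact_mod_cast h
    rw [this] at hF
    exact Fintype.card_ne_zero hF
  have hch : ringChar K ≠ 2 := fun h => h2 (by
    have := ringChar.Nat.cast_ringChar (R := K)
    rw [h] at this
    exact_mod_cast this)
  obtain ⟨l, hl⟩ := FiniteField.exists_nonsquare hch
  have hl0 : l ≠ 0 := by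
    rintro rfl
    simp at hl
  set φ := companionCoeff ν ρ with hφ
  have hφi : Function.Injective φ := companionCoeff_injective hν0 hρ0
  have hφ0 : ∀ p, p ≠ 0 → φ p ≠ 0 := by
    intro p hp h
    apply hp
    apply hφi
    rw [h, hφ, companionCoeff_zero]
  have hex : ∀ p : F × F, ∃ c, p ≠ 0 → twistedSum σ ψ p = b * signedPow a c ∧
      Nat.card (twistedRadical σ p) = Fintype.card K ^ (c.2 : ℕ) := by
    intro p
    by_cases hp : p = 0
    · exact ⟨(true, 0), fun h => absurd hp h⟩
    · obtain ⟨c, hc⟩ := exists_twistedSum_eq hψ h2 hi hσ hK hF hp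
      exact ⟨c, fun _ => hc⟩
  choose f hf using hex
  have hfu : ∀ p c, p ≠ 0 → twistedSum σ ψ p = b * signedPow a c → f p = c := by
    intro p c hp h
    rw [(hf p hp).1] at h
    exact signedPow_injective ha (by exact_mod_cast mul_left_cancel₀ hb0 h)
  have hfφ : ∀ p, p ≠ 0 → f (φ (φ p)) = f p := by
    intro p hp
    apply hfu _ _ (hφ0 _ (hφ0 _ hp))
    rw [← (hf p hp).1, hφ, companionCoeff_companionCoeff hρ, twistedSum_substCoeff hν0]
  have hfl : ∀ p, p ≠ 0 → f (l • p) = flipEven (f p) := by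
    intro p hp
    apply hfu _ _ (smul_ne_zero hl0 hp)
    rw [twistedSum_nonsquare_smul hψ h2 hn hl (hf p hp).2, signedPow_flipEven, (hf p hp).1]
    push_cast
    ring
  set X : Finset (F × F) := Finset.univ.erase 0 with hX
  have hmX : ∀ p, p ∈ X ↔ p ≠ 0 := by simp [hX]
  let n : Bool × Fin 3 → Bool × Fin 3 → ℕ := fun c c' =>
    (X.filter fun p => f p = c ∧ f (φ p) = c').card
  have hsum : ∀ {R : Type} [CommRing R] (g : Bool × Fin 3 → Bool × Fin 3 → R),
      ∑ p ∈ X, g (f p) (f (φ p)) = ∑ c, ∑ c', (n c c' : R) * g c c' := fun g =>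
    sum_comp_pair_eq_sum_card_mul X f (fun p => f (φ p)) g
  -- taking companions swaps the two members of a pair
  have hswap : ∀ c c', n c c' = n c' c := by
    have : ∀ c c', n c c' ≤ n c' c := by
      intro c c'
      refine Finset.card_le_card_of_injOn φ ?_ hφi.injOn
      intro p hp
      simp only [Finset.coe_filter, Set.mem_ofPred_eq, hmX] at hp ⊢
      exact ⟨hφ0 p hp.1, hp.2.2, by rw [hfφ p hp.1, hp.2.1]⟩
    exact fun c c' => le_antisymm (this _ _) (this _ _)
  -- scaling by a nonsquare of `K` reverses the signs for even coranks
  have hflip : ∀ c c', n (flipEven c) (flipEven c') = n c c' := by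
    have : ∀ c c', n c c' ≤ n (flipEven c) (flipEven c') := by
      intro c c'
      refine Finset.card_le_card_of_injOn (fun p => l • p) ?_ (smul_right_injective _ hl0).injOn
      intro p hp
      simp only [Finset.coe_filter, Set.mem_ofPred_eq, hmX] at hp ⊢
      refine ⟨smul_ne_zero hl0 hp.1, by rw [hfl p hp.1, hp.2.1], ?_⟩
      rw [hφ, companionCoeff_smul, ← hφ, hfl _ (hφ0 p hp.1), hp.2.2]
    intro c c'
    refine le_antisymm ?_ (this _ _)
    simpa only [flipEven_flipEven] using this (flipEven c) (flipEven c')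
  have hdeg : ∀ c c', c.2 ≠ 0 → c'.2 ≠ 0 → n c c' = 0 := by
    intro c c' hc hc'
    rw [Finset.card_eq_zero, Finset.filter_eq_empty_iff]
    rintro p hp ⟨rfl, rfl⟩
    rw [hmX] at hp
    have hj : ∀ q, q ≠ 0 → twistedRadical σ q = ⊥ → (f q).2 = 0 := by
      intro q hq h
      have := (hf q hq).2
      rw [h] at this
      have h1 : Fintype.card K ^ ((f q).2 : ℕ) = 1 := by rw [← this]; simp
      rw [Nat.pow_eq_one] at h1
      have hgt : 1 < Fintype.card K := Fintype.one_lt_card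
      exact Fin.ext (by simpa [hgt.ne'] using h1)
    rcases twistedRadical_eq_bot_or h2 hν0 hρ hH hp with h | h
    · exact hc (hj p hp h)
    · exact hc' (hj _ (hφ0 p hp) h)
  have hKc : (Fintype.card K : ℂ) = (a : ℂ) ^ 2 := by exact_mod_cast hK
  have hFc : (Fintype.card F : ℂ) = (b : ℂ) ^ 2 := by exact_mod_cast hF
  have hT0 : twistedSum σ ψ 0 = (b : ℂ) ^ 2 := by rw [twistedSum_zero, hFc]
  have hφz : φ 0 = 0 := companionCoeff_zero
  have hR0 : (Nat.card (twistedRadical σ (0 : F × F)) : ℂ) = (b : ℂ) ^ 2 := by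
    have : twistedRadical σ (0 : F × F) = ⊤ := by
      ext x
      simp [mem_twistedRadical h2]
    rw [this, ← hFc, Nat.card_congr (Submodule.topEquiv (R := K) (M := F)).toEquiv,
      Nat.card_eq_fintype_card]
  have hR : ∀ p ∈ X, (Nat.card (twistedRadical σ p) : ℂ) = (signedPow a (f p) : ℂ) ^ 2 := by
    intro p hp
    rw [hmX] at hp
    rw [(hf p hp).2, hK]
    rcases f p with ⟨s, j⟩
    cases s <;> simp [signedPow] <;> ring
  have hT : ∀ p ∈ X, twistedSum σ ψ p = b * signedPow a (f p) := fun p hp =>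
    (hf p ((hmX p).1 hp)).1
  have hTφ : ∀ p ∈ X, twistedSum σ ψ (φ p) = b * signedPow a (f (φ p)) := fun p hp =>
    (hf _ (hφ0 p ((hmX p).1 hp))).1
  have herase : ∀ g : F × F → ℂ, ∑ p ∈ X, g p = ∑ p, g p - g 0 := fun g =>
    Finset.sum_erase_eq_sub (Finset.mem_univ _)
  have M0 : ∑ c, ∑ c', (n c c' : ℂ) = (b : ℂ) ^ 4 - 1 := by
    have := hsum (R := ℂ) fun _ _ => 1
    simp only [mul_one] at this
    rw [← this, herase]
    simp only [Finset.sum_const, Finset.card_univ, Fintype.card_prod, nsmul_eq_mul, mul_one]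
    push_cast
    rw [hFc]
    ring
  have M1 : ∑ c, ∑ c', (n c c' : ℂ) * signedPow a c = (b : ℂ) * (b ^ 2 - 1) := by
    rw [← hsum (R := ℂ) fun c _ => signedPow a c]
    refine mul_left_cancel₀ hb0 ?_
    rw [Finset.mul_sum, ← Finset.sum_congr rfl hT, herase, sum_twistedSum hψ, hT0, hFc]
    ring
  have M2 : ∑ c, ∑ c', (n c c' : ℂ) * (signedPow a c : ℂ) ^ 2 =
      (b : ℂ) ^ 4 + (b ^ 2 - 1) * b ^ 2 - b ^ 2 := by
    rw [← hsum (R := ℂ) fun c _ => (signedPow a c : ℂ) ^ 2, ← Finset.sum_congr rfl hR, herase,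
      sum_card_twistedRadical h2, hR0, hFc]
    ring
  have M4 : ∑ c, ∑ c', (n c c' : ℂ) * (signedPow a c : ℂ) ^ 4 =
      (b : ℂ) ^ 4 + (b ^ 2 - 1) * b ^ 2 + (b ^ 2 - 1) * (a ^ 2 * (2 * b ^ 2 - a ^ 2)) - b ^ 4 := by
    rw [← hsum (R := ℂ) fun c _ => (signedPow a c : ℂ) ^ 4,
      Finset.sum_congr rfl fun p hp => show (signedPow a (f p) : ℂ) ^ 4 =
        (Nat.card (twistedRadical σ p) : ℂ) ^ 2 by rw [hR p hp]; ring,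
      herase fun p => (Nat.card (twistedRadical σ p) : ℂ) ^ 2,
      sum_card_twistedRadical_sq h2 hσ, hR0, hFc, hKc]
    ring
  have M11 : ∑ c, ∑ c', (n c c' : ℂ) * ((signedPow a c : ℂ) * signedPow a c') = 0 := by
    rw [← hsum (R := ℂ) fun c c' => (signedPow a c : ℂ) * signedPow a c']
    refine mul_left_cancel₀ (pow_ne_zero 2 hb0) ?_
    rw [Finset.mul_sum, Finset.sum_congr rfl fun p hp => show
      (b : ℂ) ^ 2 * ((signedPow a (f p) : ℂ) * signedPow a (f (φ p))) =
        twistedSum σ ψ p * twistedSum σ ψ (φ p) by rw [hT p hp, hTφ p hp]; ring,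
      herase fun p => twistedSum σ ψ p * twistedSum σ ψ (φ p), hφz, hT0,
      sum_twistedSum_mul_companion hψ hν, hFc]
    ring
  have M31 : ∑ c, ∑ c', (n c c' : ℂ) * ((signedPow a c : ℂ) ^ 3 * signedPow a c') =
      (b : ℂ) ^ 2 + (b ^ 2 - 1) * a ^ 2 - b ^ 4 := by
    rw [← hsum (R := ℂ) fun c c' => (signedPow a c : ℂ) ^ 3 * signedPow a c']
    refine mul_left_cancel₀ (pow_ne_zero 2 hb0) ?_
    rw [Finset.mul_sum, Finset.sum_congr rfl fun p hp => show
      (b : ℂ) ^ 2 * ((signedPow a (f p) : ℂ) ^ 3 * signedPow a (f (φ p))) =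
        (Nat.card (twistedRadical σ p) : ℂ) * (twistedSum σ ψ p * twistedSum σ ψ (φ p)) by
          rw [hT p hp, hTφ p hp, hR p hp]; ring,
      herase fun p => (Nat.card (twistedRadical σ p) : ℂ) *
        (twistedSum σ ψ p * twistedSum σ ψ (φ p)), hφz, hT0, hR0,
      sum_card_twistedRadical_mul_companion hψ h2 hσ hν hρ hH, hFc, hKc]
    ring
  obtain ⟨d1, d2, d3, d4, d5, d6⟩ := joint_distribution_of_moments (k := ℂ) (a := a) (b := b)
    (e := e) (N := fun c c' => (n c c' : ℂ)) ha (by exact_mod_cast hb)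
    (fun c c' => by rw [hswap]) (fun c c' => by rw [hflip])
    (fun c c' hc hc' => by rw [hdeg c c' hc hc', Nat.cast_zero]) M0 M1 M2 M4 M11 M31
  have hcount : (({p : F × F | twistedSum σ ψ p + twistedSum σ ψ (φ p) = v}.ncard : ℕ) : ℚ) =
      (if 2 * (b : ℂ) ^ 2 = v then 1 else 0) +
      ∑ c, ∑ c', (n c c' : ℚ) *
        if ((signedPow a c : ℂ) + signedPow a c') * b = v then 1 else 0 := by
    rw [← hsum (R := ℚ) fun c c' => if ((signedPow a c : ℂ) + signedPow a c') * b = v then 1 else 0,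
      Set.ncard_eq_toFinset_card', Set.toFinset_ofPred, ← Finset.sum_boole,
      ← Finset.add_sum_erase _ _ (Finset.mem_univ 0)]
    congr 1
    · rw [hφz, hT0, two_mul]
    · refine Finset.sum_congr rfl fun p hp => ?_
      rw [hT p hp, hTφ p hp, ← mul_add, mul_comm]
  rw [hcount, sum_signedPow_symm (R := ℚ) (N := fun c c' => (n c c' : ℚ))
    (fun c c' => by rw [hswap]) (fun c c' => by rw [hflip])
    (fun c c' hc hc' => by rw [hdeg c c' hc hc', Nat.cast_zero])
    fun x y => if ((x : ℂ) + y) * b = v then 1 else 0]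
  have q1 : (n (true, 0) (true, 0) : ℚ) = 1 / 4 * ((a : ℚ) ^ 2 - 1) * (b ^ 4 - 1) / (a ^ 2 + 1) :=
    Rat.cast_injective (α := ℂ) (by push_cast; exact d1)
  have q2 : 2 * (n (true, 0) (false, 0) : ℚ) =
      1 / 2 * ((a : ℚ) ^ 2 * b ^ 2 - 3 * b ^ 2 + a ^ 2 + 1) * (b ^ 2 - 1) / (a ^ 2 - 1) :=
    Rat.cast_injective (α := ℂ) (by push_cast; exact d2)
  have q3 : 2 * (n (true, 1) (true, 0) : ℚ) = 1 / 2 * (e : ℚ) * (e + 1) * (b ^ 2 - 1) :=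
    Rat.cast_injective (α := ℂ) (by push_cast; exact d3)
  have q4 : 2 * (n (false, 1) (true, 0) : ℚ) = 1 / 2 * (e : ℚ) * (e - 1) * (b ^ 2 - 1) :=
    Rat.cast_injective (α := ℂ) (by push_cast; exact d4)
  have q5 : (n (true, 2) (true, 0) : ℚ) = 0 := by exact_mod_cast d5
  have q6 : 2 * (n (true, 2) (false, 0) : ℚ) = ((e : ℚ) ^ 2 - 1) * (b ^ 2 - 1) / (a ^ 4 - 1) :=
    Rat.cast_injective (α := ℂ) (by push_cast; exact d6)
  simp only [totalFrequency, pairTable, List.map_cons, List.map_nil, List.sum_cons, List.sum_nil,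
    ← q1, ← q2, ← q3, ← q4, ← q6, q5]
  let h : ℂ → ℚ := fun x => if x = v then 1 else 0
  have hite : ∀ (x : ℂ) (q : ℚ), (if x = v then q else 0) = q * h x := fun x q => by simp [h]
  simp only [hite]
  push_cast
  rw [show ((1 : ℂ) + 1) * b = 2 * b by ring, show ((-1 : ℂ) + -1) * b = -2 * b by ring,
    show ((1 : ℂ) + -1) * b = 0 by ring, show ((-1 : ℂ) + 1) * b = 0 by ring,
    show ((a : ℂ) + 1) * b = (1 + a) * b by ring, show ((a : ℂ) + -1) * b = (-1 + a) * b by ring,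
    show (-(a : ℂ) + 1) * b = (1 - a) * b by ring,
    show (-(a : ℂ) + -1) * b = (-1 - a) * b by ring,
    show (1 + -(a : ℂ)) * b = (1 - a) * b by ring,
    show (-1 + -(a : ℂ)) * b = (-1 - a) * b by ring,
    show ((a : ℂ) ^ 2 + -1) * b = (a ^ 2 - 1) * b by ring,
    show (-1 + (a : ℂ) ^ 2) * b = (a ^ 2 - 1) * b by ring,
    show (-(a : ℂ) ^ 2 + 1) * b = -(a ^ 2 - 1) * b by ring,
    show (1 + -(a : ℂ) ^ 2) * b = -(a ^ 2 - 1) * b by ring]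
  ring

end Distribution

/-! ### The table of values and frequencies -/

section TableLemmas

theorem totalFrequency_of_nodup {l : List (ℂ × ℚ)} (hl : (l.map Prod.fst).Nodup)
    {row : ℂ × ℚ} (hrow : row ∈ l) : totalFrequency l row.1 = row.2 := by
  classical
  have hzero : ∀ (l : List (ℂ × ℚ)) (v : ℂ), v ∉ l.map Prod.fst → totalFrequency l v = 0 := by
    intro l v hv
    induction l with
    | nil => simp [totalFrequency]
    | cons r l ih =>
      simp only [List.map_cons, List.mem_cons, not_or] at hv
      have := ih hv.2
      simp only [totalFrequency, List.map_cons, List.sum_cons] at this ⊢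
      rw [this, if_neg (Ne.symm hv.1), zero_add]
  induction l with
  | nil => simp at hrow
  | cons r l ih =>
    rw [List.map_cons, List.nodup_cons] at hl
    rcases List.mem_cons.1 hrow with rfl | h
    · have := hzero l _ hl.1
      simp only [totalFrequency, List.map_cons, List.sum_cons, if_true] at this ⊢
      rw [this, add_zero]
    · have hne : r.1 ≠ row.1 := fun h' => hl.1 (h' ▸ List.mem_map_of_mem h)
      have := ih hl.2 h
      simp only [totalFrequency, List.map_cons, List.sum_cons] at this ⊢
      rw [if_neg hne, zero_add, this]

/-- The values in the table are distinct unless `a = 3`, where `1 - a = -2` and `-1 + a = 2`. -/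
theorem pairTable_values_nodup {a b e : ℕ} (ha : 4 ≤ a) (hb : a ^ 2 ≤ b) :
    ((pairTable a b e).map Prod.fst).Nodup := by
  have hvalues : (pairTable a b e).map Prod.fst =
      ([2 * (b : ℤ), 0, (a : ℤ) ^ 2 - 1, -((a : ℤ) ^ 2 - 1), 1 - a, -1 - a, 1 + a, -1 + a, 2,
        -2] : List ℤ).map fun w : ℤ => (w : ℂ) * b := by
    simp only [pairTable, List.map_cons, List.map_nil, List.cons.injEq]
    push_cast
    refine ⟨?_, ?_, ?_⟩
    · ring
    · ring
    · simp
  have hsq : 4 * (a : ℤ) ≤ (a : ℤ) ^ 2 := by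
    have : (4 : ℤ) ≤ a := by exact_mod_cast ha
    nlinarith
  have hb' : (a : ℤ) ^ 2 ≤ b := by exact_mod_cast hb
  have hb0 : (b : ℂ) ≠ 0 := by
    have : b ≠ 0 := by
      have : 0 < a ^ 2 := by positivity
      omega
    exact_mod_cast this
  rw [hvalues]
  refine List.Nodup.map (fun x y h => by exact_mod_cast mul_right_cancel₀ hb0 h) ?_
  generalize (a : ℤ) ^ 2 = s at *
  simp only [List.nodup_cons, List.mem_cons, List.not_mem_nil, or_false, not_or, not_false_eq_true,
    List.nodup_nil, and_true]
  omega

theorem valueTable_eq_pairTable {p m d : ℕ} (hm : Even m) (hd : Even d) (hdm : d ≤ m) :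
    valueTable p m d = pairTable (p ^ (d / 2)) (p ^ (m / 2)) (p ^ ((m - d) / 2)) := by
  have key : ∀ {R : Type} [Semiring R] (n : ℕ), Even n → ((p : R) ^ (n / 2)) ^ 2 = (p : R) ^ n := by
    intro R _ n hn
    rw [← pow_mul, Nat.div_mul_cancel hn.two_dvd]
  have key4 : ∀ n : ℕ, Even n → ((p : ℚ) ^ (n / 2)) ^ 4 = (p : ℚ) ^ (2 * n) := by
    intro n hn
    rw [show 4 = 2 * 2 by rfl, pow_mul, key n hn, ← pow_mul, mul_comm]
  simp only [valueTable, pairTable]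
  push_cast
  simp only [key m hm, key d hd, key4 m hm, key4 d hd,
    key (m - d) ((Nat.even_sub hdm).2 (iff_of_true hm hd)),
    pow_add]
  rw [mul_comm ((p : ℚ) ^ m)]

end TableLemmas

/-! ### Arithmetic of the exponents -/

section Arithmetic

/-- If `2` divides `k` more often than `m`, and `m` is even, then with `d = gcd m k` both `d` and
`k / d` are even, while `m / d` is odd. -/
theorem even_and_odd_div_of_padicValNat_lt {m k : ℕ} (hm : 0 < m) (hk : 0 < k)
    (h1 : 1 ≤ padicValNat 2 m) (h2 : padicValNat 2 m < padicValNat 2 k) :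
    Even (Nat.gcd m k) ∧ Odd (m / Nat.gcd m k) ∧ 2 * Nat.gcd m k ∣ k := by
  obtain ⟨d, m', k', hd, hco, rfl, rfl⟩ := Nat.exists_coprime' (m := m) (n := k)
    (Nat.gcd_pos_of_pos_left _ hm)
  have hm0 : m' ≠ 0 := by rintro rfl; simp at hm
  have hk0 : k' ≠ 0 := by rintro rfl; simp at hk
  have hg : Nat.gcd (m' * d) (k' * d) = d := by
    rw [Nat.gcd_mul_right, hco.gcd_eq_one, one_mul]
  rw [padicValNat.mul hm0 hd.ne'] at h1 h2
  rw [padicValNat.mul hk0 hd.ne'] at h2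
  have hk2 : 2 ∣ k' := dvd_of_one_le_padicValNat (by omega)
  have hmo : ¬2 ∣ m' := fun h => by
    have := Nat.dvd_gcd h hk2
    rw [hco.gcd_eq_one] at this
    omega
  rw [padicValNat.eq_zero_of_not_dvd hmo, zero_add] at h1
  rw [hg, Nat.mul_div_cancel _ hd]
  refine ⟨(even_iff_two_dvd).2 (dvd_of_one_le_padicValNat h1), ?_, Nat.mul_dvd_mul hk2 dvd_rfl⟩
  rwa [← Nat.not_even_iff_odd, even_iff_two_dvd]

/-- The quotient is even because the factor `p ^ d + 1` of `p ^ (2 d) - 1` is. -/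
theorem pow_sub_one_dvd_half {p d k : ℕ} (hp : Odd p) (h : 2 * d ∣ k) :
    p ^ d - 1 ∣ (p ^ k - 1) / 2 := by
  obtain ⟨t, rfl⟩ := h
  have h1 : p ^ (2 * d) - 1 ∣ p ^ (2 * d * t) - 1 := by
    rw [pow_mul p (2 * d) t]
    simpa only [one_pow] using Nat.sub_dvd_pow_sub_pow (p ^ (2 * d)) 1 t
  obtain ⟨s, hs⟩ := h1
  obtain ⟨r, hr⟩ := hp.pow (n := d)
  have h2 : p ^ (2 * d) - 1 = (p ^ d - 1) * (2 * (r + 1)) := by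
    rw [mul_comm 2 d, pow_mul, hr, show 2 * r + 1 - 1 = 2 * r by omega]
    have : (2 * r + 1) ^ 2 = 2 * r * (2 * (r + 1)) + 1 := by ring
    omega
  refine ⟨(r + 1) * s, ?_⟩
  rw [hs, h2, show (p ^ d - 1) * (2 * (r + 1)) * s = 2 * ((p ^ d - 1) * ((r + 1) * s)) by ring,
    Nat.mul_div_cancel_left _ two_pos]

end Arithmetic

/-! ### The fixed field of a power of Frobenius -/

section FrobeniusSetting

open Module

variable {p : ℕ} [Fact p.Prime] {F : Type*} [Field F] [Fintype F] [Algebra (ZMod p) F]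

/-- The subfield of `F` fixed by `x ↦ x ^ (p ^ k)`. -/
noncomputable def frobeniusFixed (p k : ℕ) [Fact p.Prime] (F : Type*) [Field F] [Fintype F]
    [Algebra (ZMod p) F] : IntermediateField (ZMod p) F :=
  IntermediateField.fixedField
    (Subgroup.zpowers (FiniteField.frobeniusAlgEquivOfAlgebraic (ZMod p) F ^ k))

theorem frobenius_pow_apply (k : ℕ) (x : F) :
    (FiniteField.frobeniusAlgEquivOfAlgebraic (ZMod p) F ^ k) x = x ^ p ^ k := by
  rw [AlgEquiv.coe_pow, FiniteField.coe_frobeniusAlgEquivOfAlgebraic_iterate, ZMod.card]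

theorem mem_frobeniusFixed {k : ℕ} {x : F} : x ∈ frobeniusFixed p k F ↔ x ^ p ^ k = x := by
  rw [frobeniusFixed, IntermediateField.mem_fixedField_iff, ← frobenius_pow_apply]
  constructor
  · intro h
    exact h _ (Subgroup.mem_zpowers _)
  · intro h g hg
    have : Subgroup.zpowers (FiniteField.frobeniusAlgEquivOfAlgebraic (ZMod p) F ^ k) ≤
        MulAction.stabilizer _ x := by
      rw [Subgroup.zpowers_le]
      exact h
    exact this hg

theorem finrank_zmod_of_card {m : ℕ} (hF : Fintype.card F = p ^ m) : finrank (ZMod p) F = m := by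
  have := card_eq_pow_finrank (K := ZMod p) (V := F)
  rw [hF, ZMod.card] at this
  exact (Nat.pow_right_injective (Fact.out : p.Prime).two_le this).symm

theorem finrank_frobeniusFixed {m k : ℕ} (hF : Fintype.card F = p ^ m) :
    finrank (frobeniusFixed p k F) F = m / Nat.gcd m k := by
  rw [frobeniusFixed, IntermediateField.finrank_fixedField_eq_card, Nat.card_zpowers,
    orderOf_pow, FiniteField.orderOf_frobeniusAlgEquivOfAlgebraic,
    finrank_zmod_of_card hF]

theorem card_frobeniusFixed {m k : ℕ} (hF : Fintype.card F = p ^ m) (hm : 0 < m)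
    [Fintype (frobeniusFixed p k F)] :
    Fintype.card (frobeniusFixed p k F) = p ^ Nat.gcd m k := by
  have h1 := finrank_mul_finrank (ZMod p) (frobeniusFixed p k F) F
  rw [finrank_frobeniusFixed hF, finrank_zmod_of_card hF] at h1
  rw [card_eq_pow_finrank (K := ZMod p), ZMod.card]
  congr 1
  have hd := Nat.gcd_dvd_left m k
  have h3 : Nat.gcd m k * (m / Nat.gcd m k) = m := Nat.mul_div_cancel' hd
  have h4 : 0 < m / Nat.gcd m k := Nat.div_pos (Nat.le_of_dvd hm hd) (Nat.gcd_pos_of_pos_left _ hm)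
  exact Nat.eq_of_mul_eq_mul_right h4 (h1.trans h3.symm)

/-- The map `x ↦ x ^ (p ^ k)` as an automorphism over its fixed field. -/
noncomputable def frobeniusOver (p k : ℕ) [Fact p.Prime] (F : Type*) [Field F] [Fintype F]
    [Algebra (ZMod p) F] : F ≃ₐ[frobeniusFixed p k F] F :=
  AlgEquiv.ofRingEquiv
    (f := (FiniteField.frobeniusAlgEquivOfAlgebraic (ZMod p) F ^ k : F ≃ₐ[ZMod p] F).toRingEquiv)
    fun x => (frobenius_pow_apply k _).trans (mem_frobeniusFixed.1 x.2)

theorem frobeniusOver_apply (k : ℕ) (x : F) : frobeniusOver p k F x = x ^ p ^ k :=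
  frobenius_pow_apply k x

/-- The additive character `x ↦ ζ ^ Tr(x)` of a finite extension of `ZMod p`. -/
noncomputable def traceChar (p : ℕ) [Fact p.Prime] {ζ : ℂ} (hζ : ζ ^ p = 1) (K : Type*) [Field K]
    [Algebra (ZMod p) K] : AddChar K ℂ :=
  (AddChar.zmodChar p hζ).compAddMonoidHom (Algebra.trace (ZMod p) K).toAddMonoidHom

theorem traceChar_ne_one {ζ : ℂ} (hζ : IsPrimitiveRoot ζ p) :
    traceChar p hζ.pow_eq_one F ≠ 1 := by
  intro h
  obtain ⟨x, hx⟩ := Algebra.trace_surjective (ZMod p) F 1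
  have h1 := DFunLike.congr_fun h x
  have h2 : AddChar.zmodChar p hζ.pow_eq_one (Algebra.trace (ZMod p) F x) = 1 := h1
  rw [hx, AddChar.zmodChar_apply, ZMod.val_one, pow_one] at h2
  exact hζ.ne_one (Fact.out : p.Prime).one_lt h2

theorem expSumT_eq_twistedSum {ζ : ℂ} (hζ : ζ ^ p = 1) (k : ℕ) (α β : F) :
    expSumT p k ζ α β =
      twistedSum (frobeniusOver p k F) (traceChar p hζ (frobeniusFixed p k F)) (α, β) := by
  unfold expSumT twistedSum
  refine Finset.sum_congr rfl fun x _ => ?_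
  change _ = AddChar.zmodChar p hζ (Algebra.trace (ZMod p) (frobeniusFixed p k F)
    (Algebra.trace (frobeniusFixed p k F) F _))
  rw [Algebra.trace_trace, AddChar.zmodChar_apply, frobeniusOver_apply, pow_succ' x]

theorem not_isSquare_of_generator {F : Type*} [Field F] [Fintype F] (hF : ringChar F ≠ 2)
    {π : Fˣ} (hπ : ∀ x : Fˣ, x ∈ Subgroup.zpowers π) : ¬IsSquare (π : F) := by
  rintro ⟨s, hs⟩
  obtain ⟨x, hx⟩ := FiniteField.exists_nonsquare hF
  have hx0 : x ≠ 0 := by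
    rintro rfl
    simp at hx
  obtain ⟨z, hz⟩ := Subgroup.mem_zpowers_iff.1 (hπ (Units.mk0 x hx0))
  apply hx
  have : x = (π : F) ^ z := by
    rw [← Units.val_zpow_eq_zpow_val, hz, Units.val_mk0]
  exact ⟨s ^ z, by rw [this, hs, mul_zpow]⟩

end FrobeniusSetting

/-! ### The value distribution -/

theorem mainTheorem1 (p m k : ℕ) [Fact p.Prime] (hp : Odd p) (hm : 0 < m) (hk : 0 < k)
    (hs : 3 ≤ m / Nat.gcd m k)
    (hv₁ : 1 ≤ padicValNat 2 m) (hv₂ : padicValNat 2 m < padicValNat 2 k)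
    {F : Type*} [Field F] [Fintype F] [Algebra (ZMod p) F] (hF : Fintype.card F = p ^ m)
    (π : Fˣ) (hπ : ∀ x : Fˣ, x ∈ Subgroup.zpowers π)
    (ζ : ℂ) (hζ : IsPrimitiveRoot ζ p) :
    (∀ v : ℂ, (({ab : F × F | expSumS p k ζ (π : F) ab.1 ab.2 = v}.ncard : ℕ) : ℚ) =
        totalFrequency (valueTable p m (Nat.gcd m k)) v) ∧
      (p ^ (Nat.gcd m k / 2) ≠ 3 → ∀ row ∈ valueTable p m (Nat.gcd m k),
        (({ab : F × F | expSumS p k ζ (π : F) ab.1 ab.2 = row.1}.ncard : ℕ) : ℚ) = row.2) := by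
  classical
  obtain ⟨hd, hodd, hdk⟩ := even_and_odd_div_of_padicValNat_lt hm hk hv₁ hv₂
  have hcardK := card_frobeniusFixed (k := k) hF hm
  have hfin := finrank_frobeniusFixed (k := k) hF
  set d := Nat.gcd m k with hddef
  have hd0 : 0 < d := Nat.gcd_pos_of_pos_left _ hm
  have hdm : d ∣ m := Nat.gcd_dvd_left m k
  have hme : Even m := hd.trans_dvd hdm
  have hke : Even k := hd.trans_dvd (Nat.gcd_dvd_right m k)
  have h3d : 3 * d ≤ m := (Nat.le_div_iff_mul_le hd0).1 hs
  have hpp : p.Prime := Fact.out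
  have hp3 : 3 ≤ p := by
    have := hpp.two_le
    obtain ⟨r, hr⟩ := hp
    omega
  obtain ⟨d', hd'⟩ := hd.two_dvd
  obtain ⟨m', hm'⟩ := hme.two_dvd
  set a := p ^ (d / 2) with ha
  set b := p ^ (m / 2) with hb
  set e := p ^ ((m - d) / 2) with he
  have ha3 : 3 ≤ a := hp3.trans (Nat.le_self_pow (by omega) p)
  have hbae : b = a * e := by
    rw [ha, hb, he, ← pow_add]
    congr 1
    omega
  have hab : a ^ 2 ≤ b := by
    rw [ha, hb, ← pow_mul]
    exact Nat.pow_le_pow_right hpp.pos (by omega)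
  have hKa : Fintype.card (frobeniusFixed p k F) = a ^ 2 := by
    rw [hcardK, ha, ← pow_mul]
    congr 1
    omega
  have hFb : Fintype.card F = b ^ 2 := by
    rw [hF, hb, ← pow_mul]
    congr 1
    omega
  have : CharP F p := charP_of_injective_algebraMap (algebraMap (ZMod p) F).injective p
  have hchF : ringChar F ≠ 2 := by
    rw [ringChar.eq F p]
    omega
  have h2F : (2 : F) ≠ 0 := Ring.two_ne_zero hchF
  have h2 : (2 : frobeniusFixed p k F) ≠ 0 := by
    intro h
    apply h2F
    have := congrArg (algebraMap (frobeniusFixed p k F) F) h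
    rwa [map_ofNat, map_zero] at this
  have hi : IsSquare (-1 : frobeniusFixed p k F) := by
    rw [FiniteField.isSquare_neg_one_iff, hKa]
    obtain ⟨r, hr⟩ : Odd a := hp.pow
    have : a ^ 2 = 4 * (r ^ 2 + r) + 1 := by rw [hr]; ring
    omega
  have hfixed : ∀ x : F, frobeniusOver p k F x = x →
      ∃ c, algebraMap (frobeniusFixed p k F) F c = x := by
    intro x hx
    rw [frobeniusOver_apply] at hx
    exact ⟨⟨x, mem_frobeniusFixed.2 hx⟩, rfl⟩
  set ν : F := -(π : F) with hν
  set ρ : F := ν ^ ((p ^ k - 1) / 2) with hρ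
  have hν0 : ν ≠ 0 := neg_ne_zero.2 π.ne_zero
  have hpk4 : p ^ k % 4 = 1 := by
    obtain ⟨k', hk'⟩ := hke.two_dvd
    obtain ⟨r, hr⟩ := hp.pow (n := k')
    have : p ^ k = 4 * (r ^ 2 + r) + 1 := by
      rw [hk', mul_comm, pow_mul, hr]
      ring
    omega
  have hρν : ρ ^ 2 * ν = frobeniusOver p k F ν := by
    rw [frobeniusOver_apply, hρ, ← pow_mul, ← pow_succ]
    congr 1
    omega
  have hns : ¬IsSquare (-ν) := by
    rw [hν, neg_neg]
    exact not_isSquare_of_generator hchF hπ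
  have hH : ∀ y, y + ρ * frobeniusOver p k F y = 0 → y = 0 := by
    intro y hy
    by_contra hy0
    -- `c = (s y)²`, where `s² = ν`, would satisfy `c ^ ((p ^ k - 1) / 2) = -1`
    have hc : (ν * y ^ 2) ^ ((p ^ k - 1) / 2) = -1 := by
      rw [mul_pow, ← hρ, ← pow_mul]
      refine mul_right_cancel₀ hy0 ?_
      rw [mul_assoc, ← pow_succ, show 2 * ((p ^ k - 1) / 2) + 1 = p ^ k by omega]
      rw [frobeniusOver_apply] at hy
      linear_combination hy
    have hc1 : (ν * y ^ 2) ^ p ^ k = ν * y ^ 2 := by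
      rw [show p ^ k = (p ^ k - 1) / 2 * 2 + 1 by omega, pow_succ, pow_mul, hc]
      ring
    have hcd : (ν * y ^ 2) ^ (p ^ d - 1) = 1 := by
      have hne : (⟨ν * y ^ 2, mem_frobeniusFixed.2 hc1⟩ : frobeniusFixed p k F) ≠ 0 := by
        intro h
        exact mul_ne_zero hν0 (pow_ne_zero 2 hy0) (congrArg Subtype.val h)
      have := FiniteField.pow_card_sub_one_eq_one _ hne
      rw [hcardK] at this
      exact congrArg Subtype.val this
    obtain ⟨t, ht⟩ := pow_sub_one_dvd_half hp hdk
    rw [ht, pow_mul, hcd, one_pow] at hc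
    exact h2F (by linear_combination hc)
  have hS : ∀ q : F × F, expSumS p k ζ (π : F) q.1 q.2 =
      twistedSum (frobeniusOver p k F) (traceChar p hζ.pow_eq_one (frobeniusFixed p k F)) q +
      twistedSum (frobeniusOver p k F) (traceChar p hζ.pow_eq_one (frobeniusFixed p k F))
        (companionCoeff ν ρ q) := by
    intro q
    rw [expSumS, expSumT_eq_twistedSum hζ.pow_eq_one, expSumT_eq_twistedSum hζ.pow_eq_one]
    congr 2
    have hπρ : (π : F) ^ ((p ^ k + 1) / 2) = -(ρ * ν) := by
      have ho : Odd ((p ^ k + 1) / 2) := by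
        rw [Nat.odd_iff]
        omega
      rw [hρ, ← pow_succ, show (p ^ k - 1) / 2 + 1 = (p ^ k + 1) / 2 by omega, hν, ho.neg_pow,
        neg_neg]
    rw [companionCoeff, hπρ]
  have htable : valueTable p m d = pairTable a b e :=
    valueTable_eq_pairTable hme hd (by omega)
  have hmain : ∀ v : ℂ, (({ab : F × F | expSumS p k ζ (π : F) ab.1 ab.2 = v}.ncard : ℕ) : ℚ) =
      totalFrequency (valueTable p m d) v := by
    intro v
    simp only [hS]
    rw [htable]
    exact ncard_twistedSum_add_companion (traceChar_ne_one hζ) h2 hi hfixed (hfin ▸ hodd) hns hρν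
      hH (by omega) hKa hFb hbae v
  refine ⟨hmain, fun h3 row hrow => ?_⟩
  rw [hmain]
  refine totalFrequency_of_nodup ?_ hrow
  rw [htable]
  exact pairTable_values_nodup (by omega) hab
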